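/- Let $K$ be an infinite field and let $n\ge 3$, $z\ge 2$ be integers. A \emph{zig-zag of length $z$} in $\mathbb P^n_K$ is a closed subscheme of the following form. There are lines $L_1,\dots,L_z\subset\mathbb P^n_K$ such that $L_i\cap L_{i+1}$ is a single point $P_i$ for $1\le i\le z-1$ and $L_i\cap L_j=\emptyset$ whenever $|i-j|\ge 2$ (so $P_1,\dots,P_{z-1}$ are distinct), and three-dimensional linear subspaces $H_i\subseteq\mathbb P^n_K$ containing $L_i\cup L_{i+1}$ for $1\le i\le z-1$; the zig-zag is the scheme-theoretic union of $L_1,\dots,L_z$ and of the first infinitesimal neighbourhoods of $P_i$ in $H_i$, i.e. its ideal sheaf is $$\bigcap_{i=1}^{z}\mathcal I_{L_i}\;\cap\;\bigcap_{i=1}^{z-1}\bigl(\mathcal I_{P_i}^2+\mathcal I_{H_i}\bigr).$$ Then there exists a closed subscheme $X\subset\mathbb P^n_{K[t]}=\mathbb P^n_K\times\mathbb A^1_K$, flat over $\mathbb A^1_K=\operatorname{Spec}K[t]$, whose fibers $X_\lambda\subset\mathbb P^n_K$ over $t=\lambda$, $\lambda\in K$, satisfy: 1. for all but finitely many $\lambda\in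 K$, $X_\lambda$ is a union of $z$ pairwise disjoint lines (with reduced structure); 2. the special fiber $X_0$ is a zig-zag of length $z$. -/

import Mathlib

open CategoryTheory AlgebraicGeometry

universe u

attribute [local instance] MvPolynomial.gradedAlgebra

noncomputable section

namespace ZigZag

/-- Projective `n`-space `ℙⁿ_R = Proj R[x₀, …, xₙ]` over a commutative ring `R`. -/
abbrev PP (n : ℕ) (R : Type u) [CommRing R] : Scheme.{u} :=
  Proj (MvPolynomial.homogeneousSubmodule (Fin (n + 1)) R)

/-- The structure morphism `ℙⁿ_R ⟶ Spec R`. -/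
def PP.structureMap (n : ℕ) (R : Type u) [CommRing R] : PP n R ⟶ Spec (.of R) :=
  Proj.toSpecZero (MvPolynomial.homogeneousSubmodule (Fin (n + 1)) R) ≫
    Spec.map (CommRingCat.ofHom
      (algebraMap R (MvPolynomial.homogeneousSubmodule (Fin (n + 1)) R 0)))

/-- The graded ring homomorphism `R[x₀, …, xₙ] → S[x₀, …, xₙ]` applying `φ` to coefficients. -/
def coeffMap (n : ℕ) {R S : Type u} [CommRing R] [CommRing S] (φ : R →+* S) :
    MvPolynomial.homogeneousSubmodule (Fin (n + 1)) R →+*ᵍ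
      MvPolynomial.homogeneousSubmodule (Fin (n + 1)) S where
  toRingHom := MvPolynomial.map φ
  map_mem h := MvPolynomial.IsHomogeneous.map h φ

theorem irrelevant_le_map_coeffMap (n : ℕ) {R S : Type u} [CommRing R] [CommRing S]
    (φ : R →+* S) :
    HomogeneousIdeal.irrelevant (MvPolynomial.homogeneousSubmodule (Fin (n + 1)) S) ≤
      (HomogeneousIdeal.irrelevant (MvPolynomial.homogeneousSubmodule (Fin (n + 1)) R)).map
        (coeffMap n φ) := by
  refine (HomogeneousIdeal.toIdeal_irrelevant_le _).mpr ?_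
  intro i hi p hp
  have hp' : p.IsHomogeneous i := hp
  change p ∈ Ideal.map (coeffMap n φ) _
  have hX : ∀ j : Fin (n + 1), (MvPolynomial.X j : MvPolynomial (Fin (n + 1)) S) ∈
      Ideal.map (coeffMap n φ) (HomogeneousIdeal.irrelevant
        (MvPolynomial.homogeneousSubmodule (Fin (n + 1)) R)).toIdeal := by
    intro j
    have h : (MvPolynomial.X j : MvPolynomial (Fin (n + 1)) R) ∈
        (HomogeneousIdeal.irrelevant
          (MvPolynomial.homogeneousSubmodule (Fin (n + 1)) R)).toIdeal :=
      HomogeneousIdeal.mem_irrelevant_of_mem _ one_pos (MvPolynomial.isHomogeneous_X R j)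
    have h2 := Ideal.mem_map_of_mem (coeffMap n φ) h
    have h3 : coeffMap n φ (MvPolynomial.X j) = MvPolynomial.X j := MvPolynomial.map_X φ j
    rwa [h3] at h2
  rw [MvPolynomial.as_sum p]
  refine Ideal.sum_mem _ fun m hm ↦ ?_
  have hdeg := hp' (MvPolynomial.mem_support_iff.mp hm)
  have hm0 : m ≠ 0 := by
    rintro rfl
    rw [map_zero] at hdeg
    omega
  obtain ⟨j, hj⟩ := Finsupp.ne_iff.mp hm0
  have hdvd : (MvPolynomial.X j : MvPolynomial (Fin (n + 1)) S) ∣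
      MvPolynomial.monomial m (p.coeff m) := by
    rw [MvPolynomial.X_dvd_monomial]
    exact Or.inr hj
  exact Ideal.mem_of_dvd _ hdvd (hX j)

/-- The morphism `ℙⁿ_S ⟶ ℙⁿ_R` induced by a ring homomorphism `φ : R → S`, given by applying `φ`
to coefficients; it exhibits `ℙⁿ_S` as the base change of `ℙⁿ_R` along `Spec S ⟶ Spec R`. -/
def PP.map (n : ℕ) {R S : Type u} [CommRing R] [CommRing S] (φ : R →+* S) : PP n S ⟶ PP n R :=
  Proj.map (coeffMap n φ) (irrelevant_le_map_coeffMap n φ)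

variable {K : Type u} [Field K] {n : ℕ}

/-- The ideal sheaf of the linear subspace `ℙ(W) ⊆ ℙⁿ_K` attached to a vector subspace
`W ⊆ Kⁿ⁺¹`, i.e. of the reduced closed subscheme cut out by all linear forms vanishing on `W`.
Its dimension is `dim W - 1`: a point, line, `ℙ³` has `dim W = 1, 2, 4`. -/
def linearSubspace (W : Submodule K (Fin (n + 1) → K)) : (PP n K).IdealSheafData :=
  Scheme.IdealSheafData.vanishingIdeal
    ⟨ProjectiveSpectrum.zeroLocus (MvPolynomial.homogeneousSubmodule (Fin (n + 1)) K)
      {ℓ | ∃ c : Fin (n + 1) → K, (∀ w ∈ W, ∑ j, c j * w j = 0) ∧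
        ℓ = ∑ j, MvPolynomial.C (c j) * MvPolynomial.X j},
      ProjectiveSpectrum.isClosed_zeroLocus _ _⟩

/-- The closed subscheme of `ℙⁿ_K` with ideal sheaf `I` is a union of `z` pairwise disjoint lines.
(The ideal sheaf of a union of subschemes is the intersection of their ideal sheaves.) -/
def IsUnionOfDisjointLines (z : ℕ) (I : (PP n K).IdealSheafData) : Prop :=
  ∃ L : Fin z → Submodule K (Fin (n + 1) → K),
    (∀ i, Module.finrank K (L i) = 2) ∧
    (∀ i j, i ≠ j → L i ⊓ L j = ⊥) ∧
    I = ⨅ i, linearSubspace (L i)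

/-- The closed subscheme of `ℙⁿ_K` with ideal sheaf `I` is a zig-zag of length `z`: there are
lines `L 0, …, L (z - 1)` such that consecutive lines meet in exactly one point
`P i = L i ∩ L (i + 1)`, nonconsecutive lines are disjoint (so the points `P i` are distinct), and
the scheme is the union of these lines and, for each `i`, of the first infinitesimal neighbourhood
of `P i` inside some linear subspace `H i ≅ ℙ³` containing `L i` and `L (i + 1)`.
That neighbourhood has ideal sheaf `𝓘(P i)² + 𝓘(H i)`; it is what makes `P i` the embedded point
of a sundial. -/
def IsZigZag (z : ℕ) (I : (PP n K).IdealSheafData) : Prop :=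
  ∃ L H : ℕ → Submodule K (Fin (n + 1) → K),
    (∀ i < z, Module.finrank K (L i) = 2) ∧
    (∀ i, i + 1 < z → Module.finrank K ↥(L i ⊓ L (i + 1)) = 1) ∧
    (∀ i j, i + 1 < j → j < z → L i ⊓ L j = ⊥) ∧
    (∀ i, i + 1 < z → Module.finrank K (H i) = 4 ∧ L i ⊔ L (i + 1) ≤ H i) ∧
    I = (⨅ i : Fin z, linearSubspace (L i)) ⊓
      ⨅ i : Fin (z - 1), (linearSubspace (L i ⊓ L (i + 1)) ^ 2 ⊔ linearSubspace (H i))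

/-- A closed subscheme of `ℙⁿ_R`, given by its ideal sheaf, is a flat family over `Spec R`. -/
def IsFlatFamily {R : Type u} [CommRing R] (I : (PP n R).IdealSheafData) : Prop :=
  Flat (I.subschemeι ≫ PP.structureMap n R)

/-- The member over `t = a` of a family of closed subschemes of `ℙⁿ` parametrized by the affine
line `Spec K[t]`: its scheme-theoretic fibre, i.e. the scheme-theoretic preimage under the
inclusion `ℙⁿ_K ⟶ ℙⁿ_{K[t]}` of the fibre at `a`. -/
def member (I : (PP n (Polynomial K)).IdealSheafData) (a : K) : (PP n K).IdealSheafData :=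
  I.comap (PP.map n (Polynomial.evalRingHom a))

end ZigZag

end

noncomputable section

namespace ZigZag

open Scheme.IdealSheafData

/-! ### Pullback of ideal sheaves along open immersions -/

section IdealSheaves

variable {X Y : Scheme.{u}}

/-! Choose distinct `a i` in `K` and the points `w i = (1, a i, …, (a i)ⁿ)` of the rational normal
curve. Over `K[t]`, let the `i`-th line be spanned by `w i + t w (i+2)` and `w (i+1)`. Lines `i` and
`i+1` stay in the fixed `ℙ³` spanned by `w i, …, w (i+3)`; at `t = 0` they meet exactly in the point
`w (i+1)`, and for `t ≠ 0` they are disjoint. Nonconsecutive lines are disjoint wherever a certain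
4×4 determinant, a polynomial in `t`, does not vanish; at `t = 0` it is a Vandermonde determinant,
so it is a nonzero polynomial. The family is the intersection of the ideal sheaves of these lines
over `K[t]`.

Flatness: each line ideal is generated by part of a basis of linear forms, so it is prime and
contains no nonzero constant. Hence the quotient by the intersection is torsion-free over the
Dedekind domain `K[t]`, and so flat.

Fibres: on a chart, passing to the fibre means extending the ideal along evaluation, and the
question is how far this commutes with intersection. It does when the extended ideals are comaximal,
that is, when the lines are disjoint (`map_iInf_of_pairwise_isCoprime`). At `t = 0`,
`map_iInf_of_chain` reduces to two consecutive lines, treated in `map_inf_eq_of_collision`. Their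
ideals are `(x, y) + U` and `(x', z) + U`, where `x'` and `x` agree at `t = 0`. The products `xx',
xz, yx', yz` specialize to `x², xz, xy, yz`; together with `U` these generate `(x, y) ∩ (x, z) ∩ (x,
y, z)²` modulo `U`, which is the ideal of the two lines with the embedded point. -/

theorem comap_inf_of_isOpenImmersion (f : X ⟶ Y) [IsOpenImmersion f] (I J : Y.IdealSheafData) :
    (I ⊓ J).comap f = I.comap f ⊓ J.comap f := by
  ext U : 2
  simp only [ideal_comap_of_isOpenImmersion, ideal_inf, Pi.inf_apply, Ideal.comap_inf]

theorem comap_iInf_of_isOpenImmersion {ι : Type*} [Finite ι] (f : X ⟶ Y) [IsOpenImmersion f]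
    (I : ι → Y.IdealSheafData) : (⨅ i, I i).comap f = ⨅ i, (I i).comap f := by
  ext U : 2
  simp only [ideal_comap_of_isOpenImmersion, ideal_iInf, iInf_apply, Ideal.comap_iInf]

theorem comap_radical_of_isOpenImmersion (f : X ⟶ Y) [IsOpenImmersion f] (I : Y.IdealSheafData) :
    I.radical.comap f = (I.comap f).radical := by
  ext U : 2
  simp only [ideal_comap_of_isOpenImmersion, radical_ideal, Ideal.comap_radical]

theorem comap_pow_of_isOpenImmersion (f : X ⟶ Y) [IsOpenImmersion f] (I : Y.IdealSheafData)
    (k : ℕ) : (I ^ k).comap f = I.comap f ^ k := by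
  ext U : 2
  -- Contraction of ideals does not respect powers in general; here it runs along an isomorphism and
  -- can be rewritten as an extension, which does.
  have h (J : Y.IdealSheafData) : (J.comap f).ideal U =
      (J.ideal ⟨f ''ᵁ U, U.2.image_of_isOpenImmersion f⟩).map (f.appIso U).hom.hom := by
    rw [ideal_comap_of_isOpenImmersion]
    exact (Ideal.map_comap_of_equiv (f.appIso U).commRingCatIsoToRingEquiv).symm
  rw [h, ideal_pow, ideal_pow, Pi.pow_apply, Pi.pow_apply, h, Ideal.map_pow]

theorem comap_vanishingIdeal_of_isOpenImmersion (f : X ⟶ Y) [IsOpenImmersion f]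
    (Z : TopologicalSpace.Closeds Y) :
    (vanishingIdeal Z).comap f = vanishingIdeal (Z.preimage f.continuous) := by
  have hs : (vanishingIdeal Z).support = Z :=
    TopologicalSpace.Closeds.ext (coe_support_vanishingIdeal Z)
  have h : (vanishingIdeal Z).radical = vanishingIdeal Z := by
    rw [← vanishingIdeal_support, hs]
  rw [← h, comap_radical_of_isOpenImmersion, ← vanishingIdeal_support, support_comap, hs]

end IdealSheaves

/-! ### Ideal sheaves on affine schemes as ideals -/

section Spec

variable {R S : CommRingCat.{u}}

/-- Closed subschemes of `Spec R` correspond to ideals of `R`. -/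
def specIdeal (R : CommRingCat.{u}) : (Spec R).IdealSheafData ≃+*o Ideal R :=
  equivOfIsAffine.trans
    { toFun := Ideal.comap (Scheme.ΓSpecIso R).inv.hom
      invFun := Ideal.comap (Scheme.ΓSpecIso R).hom.hom
      left_inv := fun I ↦ by
        rw [Ideal.comap_comap, ← CommRingCat.hom_comp, Iso.hom_inv_id, CommRingCat.hom_id,
          Ideal.comap_id]
      right_inv := fun I ↦ by
        rw [Ideal.comap_comap, ← CommRingCat.hom_comp, Iso.inv_hom_id, CommRingCat.hom_id,
          Ideal.comap_id]
      map_mul' := fun I J ↦ by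
        have h (I : Ideal Γ(Spec R, ⊤)) : I.comap (Scheme.ΓSpecIso R).inv.hom =
            I.map (Scheme.ΓSpecIso R).hom.hom :=
          (Ideal.map_comap_of_equiv (Scheme.ΓSpecIso R).commRingCatIsoToRingEquiv).symm
        simp only [h, Ideal.map_mul]
      map_add' := fun I J ↦ by
        have h (I : Ideal Γ(Spec R, ⊤)) : I.comap (Scheme.ΓSpecIso R).inv.hom =
            I.map (Scheme.ΓSpecIso R).hom.hom :=
          (Ideal.map_comap_of_equiv (Scheme.ΓSpecIso R).commRingCatIsoToRingEquiv).symm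
        simp only [h, Ideal.add_eq_sup, Ideal.map_sup]
      map_le_map_iff' := fun {I J} ↦ by
        refine ⟨fun h ↦ ?_, fun h ↦ Ideal.comap_mono h⟩
        have h2 := Ideal.comap_mono (f := (Scheme.ΓSpecIso R).hom.hom) h
        simp only [Ideal.comap_comap, ← CommRingCat.hom_comp, Iso.hom_inv_id,
          CommRingCat.hom_id, Ideal.comap_id] at h2
        exact h2 }

theorem specIdeal_apply (I : (Spec R).IdealSheafData) :
    specIdeal R I = (I.ideal ⟨⊤, isAffineOpen_top _⟩).comap (Scheme.ΓSpecIso R).inv.hom := rfl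

theorem specIdeal_map (φ : R ⟶ S) (J : (Spec S).IdealSheafData) :
    specIdeal R (J.map (Spec.map φ)) = (specIdeal S J).comap φ.hom := by
  rw [specIdeal_apply, specIdeal_apply, ideal_map_of_isAffineHom, Ideal.comap_comap,
    Ideal.comap_comap, ← CommRingCat.hom_comp, ← CommRingCat.hom_comp,
    Scheme.ΓSpecIso_inv_naturality]
  rfl

/-- Uniqueness of adjoints: pullback of ideal sheaves is left adjoint to pushforward, as extension
of ideals is to contraction, and `specIdeal_map` matches the right adjoints. -/
theorem specIdeal_comap (φ : R ⟶ S) (I : (Spec R).IdealSheafData) :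
    specIdeal S (I.comap (Spec.map φ)) = (specIdeal R I).map φ.hom := by
  refine eq_of_forall_ge_iff fun J ↦ ?_
  obtain ⟨J, rfl⟩ : ∃ J', specIdeal S J' = J := (specIdeal S).surjective J
  rw [Ideal.map_le_iff_le_comap, ← specIdeal_map, map_le_map_iff, map_le_map_iff,
    le_map_iff_comap_le]

theorem specIdeal_inf (I J : (Spec R).IdealSheafData) :
    specIdeal R (I ⊓ J) = specIdeal R I ⊓ specIdeal R J :=
  map_inf (specIdeal R) I J

theorem specIdeal_iInf {ι : Type*} [Finite ι] (I : ι → (Spec R).IdealSheafData) :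
    specIdeal R (⨅ i, I i) = ⨅ i, specIdeal R (I i) := by
  simp only [specIdeal_apply, ideal_iInf, iInf_apply, Ideal.comap_iInf]

theorem specIdeal_vanishingIdeal (Z : TopologicalSpace.Closeds (Spec R)) :
    specIdeal R (vanishingIdeal Z) =
      PrimeSpectrum.vanishingIdeal {p : PrimeSpectrum R | (show Spec R from p) ∈ Z} := by
  rw [specIdeal_apply, vanishingIdeal_ideal]
  ext x
  simp only [Ideal.mem_comap, PrimeSpectrum.mem_vanishingIdeal]
  rw [IsAffineOpen.fromSpec_top, Scheme.isoSpec_Spec_inv]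
  constructor
  · intro h p hp
    obtain ⟨q, rfl⟩ : ∃ q, (Spec.map (Scheme.ΓSpecIso R).inv) q = p :=
      (Spec.map (Scheme.ΓSpecIso R).inv).homeomorph.surjective p
    exact h q hp
  · intro h q hq
    exact h ((Spec.map (Scheme.ΓSpecIso R).inv) q) hq

end Spec

/-! ### Ideal sheaves on the standard charts of Proj -/

section Chart

variable {A : Type u} [CommRing A] {σ : Type u} [SetLike σ A] [AddSubgroupClass σ A]
  (𝒜 : ℕ → σ) [GradedRing 𝒜]

open HomogeneousLocalization

/-- The ideal of a closed subscheme of `Proj 𝒜` on the chart `D₊(s)`, where `s` has degree one. -/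
def chart {s : A} (hs : s ∈ 𝒜 1) (I : (Proj 𝒜).IdealSheafData) : Ideal (Away 𝒜 s) :=
  specIdeal (.of (Away 𝒜 s)) (I.comap (Proj.awayι 𝒜 s hs one_pos))

variable {𝒜} {s : A} (hs : s ∈ 𝒜 1)

theorem chart_inf (I J : (Proj 𝒜).IdealSheafData) :
    chart 𝒜 hs (I ⊓ J) = chart 𝒜 hs I ⊓ chart 𝒜 hs J := by
  rw [chart, comap_inf_of_isOpenImmersion]
  exact specIdeal_inf _ _

theorem chart_iInf {ι : Type*} [Finite ι] (I : ι → (Proj 𝒜).IdealSheafData) :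
    chart 𝒜 hs (⨅ i, I i) = ⨅ i, chart 𝒜 hs (I i) := by
  rw [chart, comap_iInf_of_isOpenImmersion]
  exact specIdeal_iInf _

theorem chart_sup (I J : (Proj 𝒜).IdealSheafData) :
    chart 𝒜 hs (I ⊔ J) = chart 𝒜 hs I ⊔ chart 𝒜 hs J := by
  rw [chart, comap_sup]
  exact map_sup (specIdeal _) _ _

theorem chart_pow (I : (Proj 𝒜).IdealSheafData) (k : ℕ) :
    chart 𝒜 hs (I ^ k) = chart 𝒜 hs I ^ k := by
  rw [chart, comap_pow_of_isOpenImmersion]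
  exact map_pow (specIdeal _) _ _

theorem ext_of_chart {ι : Type*} {s : ι → A} (hs : ∀ i, s i ∈ 𝒜 1)
    (hspan : (HomogeneousIdeal.irrelevant 𝒜).toIdeal ≤ Ideal.span (Set.range s))
    {I J : (Proj 𝒜).IdealSheafData} (h : ∀ i, chart 𝒜 (hs i) I = chart 𝒜 (hs i) J) : I = J := by
  refine ext_of_iSup_eq_top (fun i ↦ ⟨Proj.awayι 𝒜 (s i) (hs i) one_pos ''ᵁ ⊤,
    (isAffineOpen_top _).image_of_isOpenImmersion _⟩) ?_ fun i ↦ ?_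
  · simp only [Scheme.Hom.image_top_eq_opensRange, Proj.opensRange_awayι]
    exact Proj.iSup_basicOpen_eq_top 𝒜 s hspan
  · have h1 : I.comap (Proj.awayι 𝒜 (s i) (hs i) one_pos) =
        J.comap (Proj.awayι 𝒜 (s i) (hs i) one_pos) := (specIdeal _).injective (h i)
    have h2 := congr(($h1).ideal ⟨⊤, isAffineOpen_top _⟩)
    rw [ideal_comap_of_isOpenImmersion, ideal_comap_of_isOpenImmersion] at h2
    exact Ideal.comap_injective_of_surjective _
      ((Proj.awayι 𝒜 (s i) (hs i) one_pos).appIso ⊤).symm.commRingCatIsoToRingEquiv.surjective h2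

theorem awayι_mem_basicOpen (p : Spec (.of (Away 𝒜 s))) {g : A} (hg : g ∈ 𝒜 1) :
    Proj.awayι 𝒜 s hs one_pos p ∈ Proj.basicOpen 𝒜 g ↔
      Away.mk 𝒜 hs 1 g (by simpa using hg) ∉ (show PrimeSpectrum (Away 𝒜 s) from p).asIdeal := by
  have h := Proj.awayι_preimage_basicOpen 𝒜 hs one_pos hg one_pos
  have h2 : Proj.awayι 𝒜 s hs one_pos p ∈ Proj.basicOpen 𝒜 g ↔
      p ∈ Proj.awayι 𝒜 s hs one_pos ⁻¹ᵁ Proj.basicOpen 𝒜 g := Iff.rfl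
  rw [h2, h]
  change Away.isLocalizationElem hs hg ∉ _ ↔ _
  have h3 : Away.isLocalizationElem hs hg = Away.mk 𝒜 hs 1 g (by simpa using hg) := by
    apply HomogeneousLocalization.val_injective
    simp [Away.isLocalizationElem]
  rw [h3]

/-- On the chart `D₊(s)`, the reduced subscheme cut out by a set of linear forms is given by the
radical of the ideal generated by their quotients by `s`. -/
theorem chart_vanishingIdeal_zeroLocus {F : Set A} (hF : ∀ g ∈ F, g ∈ 𝒜 1) :
    chart 𝒜 hs (vanishingIdeal ⟨ProjectiveSpectrum.zeroLocus 𝒜 F,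
      ProjectiveSpectrum.isClosed_zeroLocus _ _⟩) =
    (Ideal.span {a | ∃ (g : A) (hg : g ∈ F),
      a = Away.mk 𝒜 hs 1 g (by simpa using hF g hg)}).radical := by
  rw [chart, comap_vanishingIdeal_of_isOpenImmersion, specIdeal_vanishingIdeal,
    ← PrimeSpectrum.vanishingIdeal_zeroLocus_eq_radical, PrimeSpectrum.zeroLocus_span]
  congr 1
  ext p
  change (∀ g ∈ F, g ∈ ((Proj.awayι 𝒜 s hs one_pos p).asHomogeneousIdeal)) ↔
    (_ : Set (Away 𝒜 s)) ⊆ _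
  constructor
  · rintro h _ ⟨g, hg, rfl⟩
    by_contra hgp
    exact (awayι_mem_basicOpen hs p (hF g hg)).mpr hgp (h g hg)
  · intro h g hg
    by_contra hgp
    exact (awayι_mem_basicOpen hs p (hF g hg)).mp hgp (h ⟨g, hg, rfl⟩)

/-- This turns fibres of the family into extensions of ideals: on charts, `Proj.map` is the spectrum
of `Away.map`. -/
theorem chart_comap_map {B : Type u} [CommRing B] {τ : Type u} [SetLike τ B]
    [AddSubgroupClass τ B] {ℬ : ℕ → τ} [GradedRing ℬ] (f : 𝒜 →+*ᵍ ℬ)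
    (hf : HomogeneousIdeal.irrelevant ℬ ≤ (HomogeneousIdeal.irrelevant 𝒜).map f)
    (I : (Proj 𝒜).IdealSheafData) :
    chart ℬ (show f s ∈ ℬ 1 from f.2 hs) (I.comap (Proj.map f hf)) =
      (chart 𝒜 hs I).map (Away.map f s) := by
  rw [chart, ← comap_comp, Proj.awayι_comp_map f hf one_pos s hs, comap_comp]
  exact specIdeal_comap _ _

end Chart

end ZigZag

end

noncomputable section

namespace ZigZag

open Scheme.IdealSheafData HomogeneousLocalization

/-! ### Flatness over the base, checked on charts -/

section Flatness

theorem specIdeal_ker_SpecMap {R S : CommRingCat.{u}} (φ : R ⟶ S) :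
    specIdeal R (Spec.map φ).ker = RingHom.ker φ.hom := by
  rw [← Scheme.IdealSheafData.map_bot, specIdeal_map, map_bot (specIdeal S)]
  rfl

theorem flat_subschemeι_comp_SpecMap {R A : CommRingCat.{u}} (φ : R ⟶ A)
    (J : (Spec A).IdealSheafData)
    (h : ((Ideal.Quotient.mk (specIdeal A J)).comp φ.hom).Flat) :
    Flat (J.subschemeι ≫ Spec.map φ) := by
  obtain ⟨I, e, he⟩ :=
    IsClosedImmersion.Spec_iff.mp (inferInstance : IsClosedImmersion J.subschemeι)
  have hI : specIdeal A J = I := by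
    rw [← J.ker_subschemeι, he, Scheme.Hom.ker_comp_of_isIso, specIdeal_ker_SpecMap]
    exact Ideal.mk_ker
  subst hI
  rw [he, Category.assoc, ← Spec.map_comp]
  have : Flat (Spec.map (φ ≫ CommRingCat.ofHom (Ideal.Quotient.mk (specIdeal A J)))) :=
    Flat.SpecMap_iff.mpr h
  infer_instance

variable (n : ℕ) (R : Type u) [CommRing R]

/-- The constants of a chart of projective space. -/
def chartC (s : MvPolynomial (Fin (n + 1)) R) :
    R →+* Away (MvPolynomial.homogeneousSubmodule (Fin (n + 1)) R) s :=
  (fromZeroRingHom _ _).comp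
    (algebraMap R (MvPolynomial.homogeneousSubmodule (Fin (n + 1)) R 0))

variable {n R}

theorem awayι_structureMap {s : MvPolynomial (Fin (n + 1)) R}
    (hs : s ∈ MvPolynomial.homogeneousSubmodule (Fin (n + 1)) R 1) :
    Proj.awayι _ s hs one_pos ≫ PP.structureMap n R =
      Spec.map (CommRingCat.ofHom (chartC n R s)) := by
  rw [PP.structureMap, Proj.awayι_toSpecZero_assoc, ← Spec.map_comp]
  rfl

theorem X_mem_homogeneousSubmodule (j : Fin (n + 1)) :
    MvPolynomial.X j ∈ MvPolynomial.homogeneousSubmodule (Fin (n + 1)) R 1 :=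
  MvPolynomial.isHomogeneous_X R j

theorem irrelevant_le_span_X : (HomogeneousIdeal.irrelevant
    (MvPolynomial.homogeneousSubmodule (Fin (n + 1)) R)).toIdeal ≤
      Ideal.span (Set.range MvPolynomial.X) := by
  refine (HomogeneousIdeal.toIdeal_irrelevant_le _).mpr ?_
  intro i hi p hp
  have hp' : p.IsHomogeneous i := hp
  change p ∈ Ideal.span _
  rw [← Set.image_univ, MvPolynomial.mem_ideal_span_X_image]
  intro m hm
  have hdeg := hp' (MvPolynomial.mem_support_iff.mp hm)
  have hm0 : m ≠ 0 := by
    rintro rfl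
    rw [map_zero] at hdeg
    omega
  obtain ⟨j, hj⟩ := Finsupp.ne_iff.mp hm0
  exact ⟨j, Set.mem_univ j, hj⟩

theorem isFlatFamily_of_chart (I : (PP n R).IdealSheafData)
    (h : ∀ j, ((Ideal.Quotient.mk (chart _ (X_mem_homogeneousSubmodule j) I)).comp
      (chartC n R (MvPolynomial.X j))).Flat) : IsFlatFamily I := by
  let 𝒰 := (Proj.affineOpenCoverOfIrrelevantLESpan
    (MvPolynomial.homogeneousSubmodule (Fin (n + 1)) R) MvPolynomial.X
    X_mem_homogeneousSubmodule (fun _ ↦ one_pos) irrelevant_le_span_X).openCover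
  have : IsZariskiLocalAtSource @Flat.{u} := HasRingHomProperty.instIsZariskiLocalAtSource
  -- Flatness is local on the source, so the standard charts are pulled back to the closed
  -- subscheme.
  refine (IsZariskiLocalAtSource.iff_of_openCover (P := @Flat.{u})
    (𝒰.pullback₁ I.subschemeι)).mpr ?_
  intro j
  let ι := Proj.awayι _ _ (X_mem_homogeneousSubmodule (R := R) j) one_pos
  change Flat (Limits.pullback.fst I.subschemeι ι ≫ I.subschemeι ≫ PP.structureMap n R)
  rw [Limits.pullback.condition_assoc, awayι_structureMap, ← Limits.pullbackSymmetry_hom_comp_fst,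
    ← comapIso_inv_subschemeι]
  have := flat_subschemeι_comp_SpecMap (CommRingCat.ofHom (chartC n R (MvPolynomial.X j))) _ (h j)
  simp only [Category.assoc]
  infer_instance

end Flatness

end ZigZag

end

noncomputable section

namespace ZigZag

open HomogeneousLocalization MvPolynomial

/-! ### Linear forms -/

section LinearForms

variable {n : ℕ} {R : Type u} [CommRing R]

/-- The linear form with coefficients `c`. -/
def lin (c : Fin (n + 1) → R) : MvPolynomial (Fin (n + 1)) R := ∑ j, C (c j) * X j

theorem lin_mem (c : Fin (n + 1) → R) : lin c ∈ homogeneousSubmodule (Fin (n + 1)) R 1 :=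
  sum_mem fun j _ ↦ by simpa using! (isHomogeneous_C _ (c j)).mul (isHomogeneous_X R j)

theorem lin_add (c d : Fin (n + 1) → R) : lin (c + d) = lin c + lin d := by
  simp [lin, add_mul, Finset.sum_add_distrib]

theorem lin_sub (c d : Fin (n + 1) → R) : lin (c - d) = lin c - lin d := by
  simp [lin, sub_mul, Finset.sum_sub_distrib]

theorem lin_smul (r : R) (c : Fin (n + 1) → R) : lin (r • c) = C r * lin c := by
  simp [lin, mul_assoc, Finset.mul_sum]

@[simp]
theorem lin_zero : lin (0 : Fin (n + 1) → R) = 0 := by simp [lin]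

theorem lin_sum {ι : Type*} (t : Finset ι) (c : ι → Fin (n + 1) → R) :
    lin (∑ i ∈ t, c i) = ∑ i ∈ t, lin (c i) := by
  classical
  induction t using Finset.induction_on with
  | empty => simp
  | insert i t hi ih => rw [Finset.sum_insert hi, lin_add, ih, Finset.sum_insert hi]

theorem lin_single (j : Fin (n + 1)) : lin (Pi.single j 1 : Fin (n + 1) → R) = X j := by
  simp [lin, Pi.single_apply]

theorem coeff_lin (c : Fin (n + 1) → R) (j : Fin (n + 1)) :
    (lin c).coeff (Finsupp.single j 1) = c j := by
  simp [lin, coeff_sum, coeff_C_mul, coeff_X, Finsupp.single_left_inj]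

theorem lin_eq_zero {c : Fin (n + 1) → R} (h : lin c = 0) : c = 0 := by
  funext j
  rw [← coeff_lin c j, h, coeff_zero, Pi.zero_apply]

theorem map_lin {S : Type u} [CommRing S] (φ : R →+* S) (c : Fin (n + 1) → R) :
    MvPolynomial.map φ (lin c) = lin (φ ∘ c) := by
  simp [lin]

end LinearForms

/-! ### Ideals of linear forms on a chart -/

section Dehomogenization

variable {n : ℕ} {R : Type u} [CommRing R] {s : MvPolynomial (Fin (n + 1)) R}
  (hs : s ∈ homogeneousSubmodule (Fin (n + 1)) R 1)

/-- Dehomogenization with respect to the linear form `s`. -/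
def dehom : MvPolynomial (Fin (n + 1)) R →+* Away (homogeneousSubmodule (Fin (n + 1)) R) s :=
  eval₂Hom (chartC n R s) fun j ↦ Away.mk _ hs 1 (X j) (by simpa using X_mem_homogeneousSubmodule j)

theorem dehom_C (r : R) : dehom hs (C r) = chartC n R s r := eval₂Hom_C _ _ _

theorem val_chartC (r : R) : (chartC n R s r).val =
    algebraMap (MvPolynomial (Fin (n + 1)) R) (Localization.Away s) (C r) := by
  change Localization.mk _ _ = _
  exact Localization.mk_one_eq_algebraMap _

theorem val_dehom_X (j : Fin (n + 1)) :
    (dehom hs (X j)).val = algebraMap (MvPolynomial (Fin (n + 1)) R) (Localization.Away s) (X j) *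
      IsLocalization.Away.invSelf s := by
  rw [dehom, eval₂Hom_X', Away.val_mk, Localization.mk_eq_mk', IsLocalization.mk'_eq_mul_mk'_one]
  simp [IsLocalization.Away.invSelf]

theorem val_dehom {p : MvPolynomial (Fin (n + 1)) R} {d : ℕ}
    (hp : p ∈ homogeneousSubmodule (Fin (n + 1)) R d) :
    (dehom hs p).val =
      algebraMap _ (Localization.Away s) p * IsLocalization.Away.invSelf s ^ d := by
  let Φ : MvPolynomial (Fin (n + 1)) R →+* Localization.Away s :=
    (algebraMap (Away (homogeneousSubmodule (Fin (n + 1)) R) s) (Localization.Away s)).comp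
      (dehom hs)
  have hΦ (q) : (dehom hs q).val = Φ q := (HomogeneousLocalization.algebraMap_apply _).symm
  have hp' : p.IsHomogeneous d := hp
  rw [hΦ, p.as_sum, map_sum, map_sum, Finset.sum_mul]
  refine Finset.sum_congr rfl fun m hm ↦ ?_
  have hdeg : ∑ j ∈ m.support, m j = d := by
    have h := hp' (mem_support_iff.mp hm)
    rw [← h, Finsupp.weight_apply]
    simp [Finsupp.sum]
  rw [monomial_eq, map_mul, map_mul, mul_assoc, ← hΦ, dehom_C, val_chartC]
  congr 1
  rw [Finsupp.prod, map_prod, map_prod, ← hdeg, ← Finset.prod_pow_eq_pow_sum,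
    ← Finset.prod_mul_distrib]
  refine Finset.prod_congr rfl fun j _ ↦ ?_
  rw [map_pow, map_pow, ← hΦ, val_dehom_X, mul_pow]

theorem dehom_eq_mk {p : MvPolynomial (Fin (n + 1)) R} {d : ℕ}
    (hp : p ∈ homogeneousSubmodule (Fin (n + 1)) R d) :
    dehom hs p = Away.mk _ hs d p (by simpa using hp) := by
  apply val_injective
  rw [val_dehom hs hp, Away.val_mk, Localization.mk_eq_mk', IsLocalization.mk'_eq_mul_mk'_one]
  congr 1
  rw [IsLocalization.Away.invSelf, ← IsLocalization.mk'_pow]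
  simp

theorem exists_dehom_eq (a : Away (homogeneousSubmodule (Fin (n + 1)) R) s) :
    ∃ d, ∃ p ∈ homogeneousSubmodule (Fin (n + 1)) R d, dehom hs p = a := by
  obtain ⟨d, p, hp, rfl⟩ := Away.mk_surjective _ hs a
  have hp' : p ∈ homogeneousSubmodule (Fin (n + 1)) R d := by simpa using hp
  exact ⟨d, p, hp', dehom_eq_mk hs hp'⟩

theorem dehom_self : dehom hs s = 1 := by
  apply val_injective
  rw [val_dehom hs hs, pow_one, val_one, IsLocalization.Away.mul_invSelf]

theorem map_dehom {S : Type u} [CommRing S] (φ : R →+* S) (p : MvPolynomial (Fin (n + 1)) R) :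
    Away.map (coeffMap n φ) s (dehom hs p) =
      dehom (show coeffMap n φ s ∈ homogeneousSubmodule (Fin (n + 1)) S 1 from
        (coeffMap n φ).2 hs) (MvPolynomial.map φ p) := by
  have hs' : coeffMap n φ s ∈ homogeneousSubmodule (Fin (n + 1)) S 1 := (coeffMap n φ).2 hs
  obtain h : (Away.map (coeffMap n φ) s).comp (dehom hs) =
      (dehom hs').comp (MvPolynomial.map φ) := by
    refine MvPolynomial.ringHom_ext (fun r ↦ ?_) fun j ↦ ?_
    · have hC (r : R) := dehom_eq_mk hs (isHomogeneous_C (Fin (n + 1)) r)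
      have hC' (r : S) := dehom_eq_mk hs' (isHomogeneous_C (Fin (n + 1)) r)
      rw [RingHom.comp_apply, RingHom.comp_apply, map_C, hC, hC', Away.map_mk]
      congr 1
      exact map_C φ r
    · rw [RingHom.comp_apply, RingHom.comp_apply, map_X,
        dehom_eq_mk hs (X_mem_homogeneousSubmodule j),
        dehom_eq_mk hs' (X_mem_homogeneousSubmodule j), Away.map_mk]
      congr 1
      exact map_X φ j
  exact congr($h p)

/-- The chart of an ideal generated by linear forms, in terms of homogeneous polynomials. -/
theorem dehom_mem_map_span {F : Set (MvPolynomial (Fin (n + 1)) R)}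
    (hF : ∀ g ∈ F, g ∈ homogeneousSubmodule (Fin (n + 1)) R 1)
    {p : MvPolynomial (Fin (n + 1)) R} {d : ℕ}
    (hp : p ∈ homogeneousSubmodule (Fin (n + 1)) R d) :
    dehom hs p ∈ (Ideal.span F).map (dehom hs) ↔ ∃ m : ℕ, s ^ m * p ∈ Ideal.span F := by
  constructor
  · intro h
    have h2 := Ideal.mem_map_of_mem (algebraMap
      (Away (homogeneousSubmodule (Fin (n + 1)) R) s) (Localization.Away s)) h
    have hle : ((Ideal.span F).map (dehom hs)).map (algebraMap
      (Away (homogeneousSubmodule (Fin (n + 1)) R) s) (Localization.Away s)) ≤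
        (Ideal.span F).map (algebraMap _ (Localization.Away s)) := by
      rw [Ideal.map_span, Ideal.map_span, Ideal.span_le]
      rintro _ ⟨_, ⟨g, hg, rfl⟩, rfl⟩
      rw [HomogeneousLocalization.algebraMap_apply, val_dehom hs (hF g hg)]
      exact Ideal.mul_mem_right _ _ (Ideal.mem_map_of_mem _ (Ideal.subset_span hg))
    have h3 := hle h2
    rw [HomogeneousLocalization.algebraMap_apply, val_dehom hs hp] at h3
    have h4 : algebraMap _ (Localization.Away s) p ∈
        (Ideal.span F).map (algebraMap _ (Localization.Away s)) := by
      have := Ideal.mul_mem_right (algebraMap _ (Localization.Away s) s ^ d) _ h3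
      rwa [mul_assoc, ← mul_pow, mul_comm (IsLocalization.Away.invSelf s),
        IsLocalization.Away.mul_invSelf, one_pow, mul_one] at this
    obtain ⟨_, ⟨m, rfl⟩, hm⟩ :=
      (IsLocalization.algebraMap_mem_map_algebraMap_iff (Submonoid.powers s) _ _ _).mp h4
    exact ⟨m, hm⟩
  · rintro ⟨m, hm⟩
    have := Ideal.mem_map_of_mem (dehom hs) hm
    rwa [map_mul, map_pow, dehom_self, one_pow, one_mul] at this

/-- Clearing denominators moves the relation to the polynomial ring, where primality applies.
Cancellation is stated instead of primality on the chart because the extended ideal is the unit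
ideal when `s` lies in `span F`. -/
theorem mem_map_dehom_of_mul_mem {F : Set (MvPolynomial (Fin (n + 1)) R)}
    (hF : ∀ g ∈ F, g ∈ homogeneousSubmodule (Fin (n + 1)) R 1) (hP : (Ideal.span F).IsPrime)
    {q : MvPolynomial (Fin (n + 1)) R} {e : ℕ}
    (hq : q ∈ homogeneousSubmodule (Fin (n + 1)) R e) (hqF : q ∉ Ideal.span F)
    {a : Away (homogeneousSubmodule (Fin (n + 1)) R) s}
    (ha : a * dehom hs q ∈ (Ideal.span F).map (dehom hs)) :
    a ∈ (Ideal.span F).map (dehom hs) := by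
  obtain ⟨d, p, hp, rfl⟩ := exists_dehom_eq hs a
  rw [← map_mul, dehom_mem_map_span hs hF (SetLike.mul_mem_graded hp hq)] at ha
  obtain ⟨m, hm⟩ := ha
  rw [← mul_assoc] at hm
  exact (dehom_mem_map_span hs hF hp).mpr ⟨m, (hP.mem_or_mem hm).resolve_right hqF⟩

theorem isRadical_map_dehom {F : Set (MvPolynomial (Fin (n + 1)) R)}
    (hF : ∀ g ∈ F, g ∈ homogeneousSubmodule (Fin (n + 1)) R 1) (hP : (Ideal.span F).IsPrime) :
    ((Ideal.span F).map (dehom hs)).IsRadical := by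
  rintro a ⟨k, hk⟩
  obtain ⟨d, p, hp, rfl⟩ := exists_dehom_eq hs a
  rw [← map_pow, dehom_mem_map_span hs hF (SetLike.pow_mem_graded k hp)] at hk
  obtain ⟨m, hm⟩ := hk
  refine (dehom_mem_map_span hs hF hp).mpr ⟨m, ?_⟩
  rcases hP.mem_or_mem hm with h | h
  · exact Ideal.mul_mem_right _ _ h
  · exact Ideal.mul_mem_left _ _ (hP.mem_of_pow_mem k h)

/-- Primality makes the extended ideal radical, so the radical built into the reduced structure can
be dropped and the linear forms themselves generate. -/
theorem chart_vanishingIdeal_of_isPrime {F : Set (MvPolynomial (Fin (n + 1)) R)}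
    (hF : ∀ g ∈ F, g ∈ homogeneousSubmodule (Fin (n + 1)) R 1) (hP : (Ideal.span F).IsPrime) :
    chart _ hs (Scheme.IdealSheafData.vanishingIdeal
      ⟨ProjectiveSpectrum.zeroLocus (homogeneousSubmodule (Fin (n + 1)) R) F,
        ProjectiveSpectrum.isClosed_zeroLocus _ _⟩) = (Ideal.span F).map (dehom hs) := by
  rw [chart_vanishingIdeal_zeroLocus hs hF, ← (isRadical_map_dehom hs hF hP).radical,
    Ideal.map_span]
  congr 2
  ext a
  constructor
  · rintro ⟨g, hg, rfl⟩
    exact ⟨g, hg, dehom_eq_mk hs (hF g hg)⟩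
  · rintro ⟨g, hg, rfl⟩
    exact ⟨g, hg, dehom_eq_mk hs (hF g hg)⟩

end Dehomogenization

end ZigZag

end

namespace ZigZag

/-! ### Extension of intersections of ideals -/

section CommutativeAlgebra

variable {A B : Type*} [CommRing A] [CommRing B] {ψ : A →+* B}

/-- The intersection of comaximal ideals is their product, extension commutes with products, and a
product of ideals is contained in their intersection. -/
theorem map_iInf_of_pairwise_isCoprime {ι : Type*} [Finite ι] (I : ι → Ideal A)
    (h : ∀ i j, i ≠ j → (I i).map ψ ⊔ (I j).map ψ = ⊤) :
    (⨅ i, I i).map ψ = ⨅ i, (I i).map ψ := by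
  have := Fintype.ofFinite ι
  refine le_antisymm (le_iInf fun i ↦ Ideal.map_mono (iInf_le I i)) ?_
  have h2 : ⨅ i, (I i).map ψ = ∏ i, (I i).map ψ := by
    rw [Ideal.prod_eq_iInf_of_pairwise_isCoprime fun i _ j _ hij ↦
      Ideal.isCoprime_iff_sup_eq.mpr (h i j hij)]
    simp
  have h3 : ∏ i, (I i).map ψ = (∏ i, I i).map ψ := (map_prod (Ideal.mapHom ψ) I _).symm
  rw [h2, h3]
  refine Ideal.map_mono (le_iInf fun i ↦ ?_)
  exact Ideal.prod_le_inf.trans (Finset.inf_le (Finset.mem_univ i))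

/-- The image of an intersection of a chain of ideals, in which nonconsecutive members become
comaximal, is determined by the intersections of consecutive members. -/
theorem map_iInf_of_chain (hψ : Function.Surjective ψ) {z : ℕ} (hz : 2 ≤ z) (I : ℕ → Ideal A)
    (Q : ℕ → Ideal B)
    (hI : ∀ i j, i + 1 < j → j < z → (I i).map ψ ⊔ (I j).map ψ = ⊤)
    (hQ : ∀ i, i + 1 < z →
      (I i ⊓ I (i + 1)).map ψ = (I i).map ψ ⊓ (I (i + 1)).map ψ ⊓ Q i) :
    (⨅ i : Fin z, I i).map ψ = (⨅ i : Fin z, (I i).map ψ) ⊓ ⨅ i : Fin (z - 1), Q i := by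
  apply le_antisymm
  · refine le_inf (le_iInf fun i ↦ Ideal.map_mono (iInf_le _ i)) (le_iInf fun i ↦ ?_)
    have hi : (i : ℕ) + 1 < z := by omega
    refine le_trans (Ideal.map_mono (le_inf ?_ ?_)) ((hQ i hi).le.trans inf_le_right)
    · exact iInf_le (fun i : Fin z ↦ I i) ⟨i, by omega⟩
    · exact iInf_le (fun i : Fin z ↦ I i) ⟨i + 1, hi⟩
  · rintro g ⟨hgJ, hgQ⟩
    simp only [SetLike.mem_coe, Submodule.mem_iInf] at hgJ hgQ
    by_contra hg
    -- Membership of `g` is checked locally: otherwise the ideal of multipliers taking `g` into the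
    -- extended intersection lies in a maximal ideal `M`.
    have hne : ((⨅ i : Fin z, I i).map ψ).colon {g} ≠ ⊤ := fun h ↦ hg <| by
      have h1 : (1 : B) ∈ ((⨅ i : Fin z, I i).map ψ).colon {g} := h ▸ Submodule.mem_top
      simpa using Submodule.mem_colon_singleton.mp h1
    obtain ⟨M, hM, hle⟩ := Ideal.exists_le_maximal _ hne
    -- By comaximality, `M` contains at most two of the extended ideals, and these are consecutive.
    -- If the least index contained is the last one, the pair begins at `z - 2`; if none is
    -- contained, any pair works, and 0 is used.
    obtain ⟨i₀, hi₀, hj⟩ : ∃ i₀, i₀ + 1 < z ∧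
        ∀ j < z, j ≠ i₀ → j ≠ i₀ + 1 → ¬ (I j).map ψ ≤ M := by
      by_cases hex : ∃ i, i < z ∧ (I i).map ψ ≤ M
      · classical
        obtain ⟨h1, h2⟩ := Nat.find_spec hex
        have hmin := fun j (h : j < Nat.find hex) ↦ Nat.find_min hex h
        set i := Nat.find hex
        by_cases hi : i + 1 < z
        · refine ⟨i, hi, fun j hj hji hji' hjM ↦ ?_⟩
          rcases lt_or_ge j i with h | h
          · exact hmin j h ⟨hj, hjM⟩
          · exact hM.ne_top (top_le_iff.mp ((hI i j (by omega) hj).ge.trans (sup_le h2 hjM)))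
        · refine ⟨z - 2, by omega, fun j hj hji hji' hjM ↦ ?_⟩
          exact hmin j (by omega) ⟨hj, hjM⟩
      · push Not at hex
        exact ⟨0, by omega, fun j hj _ _ ↦ hex j hj⟩
    have hg2 : g ∈ (I i₀ ⊓ I (i₀ + 1)).map ψ := by
      rw [hQ i₀ hi₀]
      exact ⟨⟨hgJ ⟨i₀, by omega⟩, hgJ ⟨i₀ + 1, hi₀⟩⟩, hgQ ⟨i₀, by omega⟩⟩
    obtain ⟨f, hf, rfl⟩ := (Ideal.mem_map_iff_of_surjective ψ hψ).mp hg2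
    -- Away from the pair, each `I j` has an element whose image is outside `M`. Multiplying by all
    -- of them moves a lift of `g` from the intersection of the pair into the full intersection, so
    -- their product multiplies `g` into the extension without lying in `M`.
    have hex : ∀ j : Fin z, ∃ s : A, ψ s ∉ M ∧ ((j : ℕ) ≠ i₀ → (j : ℕ) ≠ i₀ + 1 → s ∈ I j) := by
      intro j
      by_cases h : (j : ℕ) ≠ i₀ ∧ (j : ℕ) ≠ i₀ + 1
      · obtain ⟨b, hb, hbM⟩ := SetLike.not_le_iff_exists.mp (hj j j.2 h.1 h.2)
        obtain ⟨s, hs, rfl⟩ := (Ideal.mem_map_iff_of_surjective ψ hψ).mp hb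
        exact ⟨s, hbM, fun _ _ ↦ hs⟩
      · refine ⟨1, ?_, fun h1 h2 ↦ absurd ⟨h1, h2⟩ h⟩
        rw [map_one]
        exact (Ideal.ne_top_iff_one M).mp hM.ne_top
    choose s hsM hsI using hex
    have hprod : ψ (∏ j, s j) ∈ M := by
      apply hle
      rw [Submodule.mem_colon_singleton, smul_eq_mul, ← map_mul]
      refine Ideal.mem_map_of_mem ψ ((Submodule.mem_iInf _).mpr fun j ↦ ?_)
      by_cases h1 : (j : ℕ) = i₀
      · exact h1 ▸ Ideal.mul_mem_left _ _ hf.1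
      by_cases h2 : (j : ℕ) = i₀ + 1
      · exact h2 ▸ Ideal.mul_mem_left _ _ hf.2
      · exact Ideal.mul_mem_right _ _
          (Ideal.mem_of_dvd _ (Finset.dvd_prod_of_mem s (Finset.mem_univ j)) (hsI j h1 h2))
    rw [map_prod] at hprod
    obtain ⟨j, -, hj⟩ := (hM.isPrime.prod_mem_iff).mp hprod
    exact hsM j hj

theorem mem_span_pair_sup {a b c : A} {U : Ideal A} :
    c ∈ Ideal.span {a, b} ⊔ U ↔ ∃ p q, ∃ u ∈ U, p * a + q * b + u = c := by
  simp only [Submodule.mem_sup, Ideal.mem_span_pair]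
  constructor
  · rintro ⟨_, ⟨p, q, rfl⟩, u, hu, rfl⟩
    exact ⟨p, q, u, hu, rfl⟩
  · rintro ⟨p, q, u, hu, rfl⟩
    exact ⟨_, ⟨p, q, rfl⟩, u, hu, rfl⟩

theorem mem_span_triple_sup {a b c d : A} {U : Ideal A} :
    d ∈ Ideal.span {a, b, c} ⊔ U ↔ ∃ p q r, ∃ u ∈ U, p * a + q * b + r * c + u = d := by
  simp only [Submodule.mem_sup, Ideal.mem_span_insert, Ideal.mem_span_singleton']
  constructor
  · rintro ⟨_, ⟨p, _, ⟨q, _, ⟨r, rfl⟩, rfl⟩, rfl⟩, u, hu, rfl⟩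
    exact ⟨p, q, r, u, hu, by ring⟩
  · rintro ⟨p, q, r, u, hu, rfl⟩
    exact ⟨_, ⟨p, _, ⟨q, _, ⟨r, rfl⟩, rfl⟩, rfl⟩, u, hu, by ring⟩

/-- The limit of two disjoint lines `x = y = 0` and `x' = z = 0` that meet in the limit, where `x`
and `x'` agree: the union of the limit lines and of the first infinitesimal neighbourhood of their
intersection point inside the span `U = 0` of the two lines. -/
theorem map_inf_eq_of_collision {x x' y z : A} (U : Ideal A)
    (hx : ψ x' = ψ x)
    (h₁ : ∀ a, a * (x - x') ∈ Ideal.span {y, x', z} ⊔ U → a ∈ Ideal.span {y, x', z} ⊔ U)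
    (h₂ : ∀ b, b * ψ y ∈ Ideal.span {ψ x, ψ z} ⊔ U.map ψ → b ∈ Ideal.span {ψ x, ψ z} ⊔ U.map ψ)
    (h₃ : ∀ b, b * ψ z ∈ Ideal.span {ψ x, ψ y} ⊔ U.map ψ → b ∈ Ideal.span {ψ x, ψ y} ⊔ U.map ψ) :
    ((Ideal.span {x, y} ⊔ U) ⊓ (Ideal.span {x', z} ⊔ U)).map ψ =
      (Ideal.span {ψ x, ψ y} ⊔ U.map ψ) ⊓ (Ideal.span {ψ x, ψ z} ⊔ U.map ψ) ⊓
        ((Ideal.span {ψ x, ψ y, ψ z} ⊔ U.map ψ) ^ 2 ⊔ U.map ψ) := by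
  have hmap (a b : A) : (Ideal.span {a, b} ⊔ U).map ψ = Ideal.span {ψ a, ψ b} ⊔ U.map ψ := by
    rw [Ideal.map_sup, Ideal.map_span, Set.image_pair]
  set P := Ideal.span {ψ x, ψ y, ψ z} ⊔ U.map ψ with hP
  have hxP : ψ x ∈ P := (le_sup_left : _ ≤ P) (Ideal.subset_span (by simp))
  have hyP : ψ y ∈ P := (le_sup_left : _ ≤ P) (Ideal.subset_span (by simp))
  have hzP : ψ z ∈ P := (le_sup_left : _ ≤ P) (Ideal.subset_span (by simp))
  have hUP : U.map ψ ≤ P := le_sup_right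
  apply le_antisymm
  · rw [Ideal.map_le_iff_le_comap]
    rintro f ⟨hf₁, hf₂⟩
    have hf₁' := Ideal.mem_map_of_mem ψ hf₁
    have hf₂' := Ideal.mem_map_of_mem ψ hf₂
    rw [hmap] at hf₁' hf₂'
    rw [hx] at hf₂'
    refine ⟨⟨hf₁', hf₂'⟩, ?_⟩
    obtain ⟨α, β, u, hu, rfl⟩ := mem_span_pair_sup.mp hf₁
    -- Writing the same element in terms of the second line shows `α * (x - x')` lies in the ideal
    -- of `y`, `x'`, `z` and `U`, and `h₁` cancels `x - x'`. This must be done before applying `ψ`,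
    -- which kills `x - x'`.
    obtain ⟨γ, δ, ε, v, hv, hα⟩ : ∃ p q r, ∃ v ∈ U, p * y + q * x' + r * z + v = α := by
      rw [← mem_span_triple_sup]
      refine h₁ α ?_
      obtain ⟨p, q, w, hw, he⟩ := mem_span_pair_sup.mp hf₂
      refine mem_span_triple_sup.mpr ⟨-β, p - α, q, w - u, sub_mem hw hu, ?_⟩
      linear_combination he
    have hβ : ψ β ∈ Ideal.span {ψ x, ψ z} ⊔ U.map ψ := by
      refine h₂ _ ?_
      obtain ⟨p, q, w, hw, he⟩ := mem_span_pair_sup.mp hf₂'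
      refine mem_span_pair_sup.mpr ⟨p - ψ α, q, w - ψ u, sub_mem hw (Ideal.mem_map_of_mem ψ hu), ?_⟩
      rw [map_add, map_add, map_mul, map_mul] at he
      linear_combination he
    obtain ⟨p, q, w, hw, he⟩ := mem_span_pair_sup.mp hβ
    change ψ (α * x + β * y + u) ∈ P ^ 2 ⊔ U.map ψ
    have h1 : ψ α ∈ P := by
      rw [← hα, map_add, map_add, map_add, map_mul, map_mul, map_mul, hx]
      exact add_mem (add_mem (add_mem (Ideal.mul_mem_left _ _ hyP) (Ideal.mul_mem_left _ _ hxP))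
        (Ideal.mul_mem_left _ _ hzP)) (hUP (Ideal.mem_map_of_mem ψ hv))
    have h2 : ψ β ∈ P := by
      rw [← he]
      exact add_mem (add_mem (Ideal.mul_mem_left _ _ hxP) (Ideal.mul_mem_left _ _ hzP)) (hUP hw)
    rw [map_add, map_add, map_mul, map_mul, sq]
    exact add_mem ((le_sup_left : _ ≤ P * P ⊔ U.map ψ)
      (add_mem (Ideal.mul_mem_mul h1 hxP) (Ideal.mul_mem_mul h2 hyP)))
      ((le_sup_right : _ ≤ P * P ⊔ U.map ψ) (Ideal.mem_map_of_mem ψ hu))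
  · set N := ((Ideal.span {x, y} ⊔ U) ⊓ (Ideal.span {x', z} ⊔ U)).map ψ with hN
    have hx₁ : x ∈ Ideal.span {x, y} ⊔ U :=
      (le_sup_left : _ ≤ Ideal.span {x, y} ⊔ U) (Ideal.subset_span (by simp))
    have hy₁ : y ∈ Ideal.span {x, y} ⊔ U :=
      (le_sup_left : _ ≤ Ideal.span {x, y} ⊔ U) (Ideal.subset_span (by simp))
    have hx₂ : x' ∈ Ideal.span {x', z} ⊔ U :=
      (le_sup_left : _ ≤ Ideal.span {x', z} ⊔ U) (Ideal.subset_span (by simp))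
    have hz₂ : z ∈ Ideal.span {x', z} ⊔ U :=
      (le_sup_left : _ ≤ Ideal.span {x', z} ⊔ U) (Ideal.subset_span (by simp))
    have hxx : ψ x * ψ x ∈ N := by
      have := Ideal.mem_map_of_mem ψ (I := (Ideal.span {x, y} ⊔ U) ⊓ (Ideal.span {x', z} ⊔ U))
        ⟨Ideal.mul_mem_right x' _ hx₁, Ideal.mul_mem_left _ x hx₂⟩
      rwa [map_mul, hx] at this
    have hxy : ψ x * ψ y ∈ N := by
      have := Ideal.mem_map_of_mem ψ (I := (Ideal.span {x, y} ⊔ U) ⊓ (Ideal.span {x', z} ⊔ U))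
        ⟨Ideal.mul_mem_left _ x' hy₁, Ideal.mul_mem_right y _ hx₂⟩
      rwa [map_mul, hx] at this
    have hxz : ψ x * ψ z ∈ N := by
      have := Ideal.mem_map_of_mem ψ (I := (Ideal.span {x, y} ⊔ U) ⊓ (Ideal.span {x', z} ⊔ U))
        ⟨Ideal.mul_mem_right z _ hx₁, Ideal.mul_mem_left _ x hz₂⟩
      rwa [map_mul] at this
    have hyz : ψ y * ψ z ∈ N := by
      have := Ideal.mem_map_of_mem ψ (I := (Ideal.span {x, y} ⊔ U) ⊓ (Ideal.span {x', z} ⊔ U))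
        ⟨Ideal.mul_mem_right z _ hy₁, Ideal.mul_mem_left _ y hz₂⟩
      rwa [map_mul] at this
    have hUN : U.map ψ ≤ N := Ideal.map_mono (le_inf le_sup_right le_sup_right)
    have hN₁ : N ≤ Ideal.span {ψ x, ψ y} ⊔ U.map ψ := hmap x y ▸ Ideal.map_mono inf_le_left
    have hN₂ : N ≤ Ideal.span {ψ x, ψ z} ⊔ U.map ψ := by
      have := hmap x' z ▸ Ideal.map_mono (f := ψ)
        (inf_le_right : (Ideal.span {x, y} ⊔ U) ⊓ (Ideal.span {x', z} ⊔ U) ≤ _)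
      rwa [hx] at this
    -- Of the quadratic monomials in `x, y, z`, only `y²` and `z²` are not already in `N`.
    have hP2 : P ^ 2 ⊔ U.map ψ ≤ Ideal.span {ψ y * ψ y, ψ z * ψ z} ⊔ N := by
      set T := Ideal.span {ψ y * ψ y, ψ z * ψ z} ⊔ N with hT
      have hNT : N ≤ T := le_sup_right
      have hyy : ψ y * ψ y ∈ T := (le_sup_left : _ ≤ T) (Ideal.subset_span (by simp))
      have hzz : ψ z * ψ z ∈ T := (le_sup_left : _ ≤ T) (Ideal.subset_span (by simp))
      refine sup_le ?_ (hUN.trans hNT)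
      rw [sq, Ideal.mul_le]
      intro a ha b hb
      obtain ⟨p, q, r, u, hu, rfl⟩ := mem_span_triple_sup.mp ha
      obtain ⟨p', q', r', u', hu', rfl⟩ := mem_span_triple_sup.mp hb
      have hs : ψ x * ψ x ∈ T ∧ ψ x * ψ y ∈ T ∧ ψ x * ψ z ∈ T ∧ ψ y * ψ z ∈ T :=
        ⟨hNT hxx, hNT hxy, hNT hxz, hNT hyz⟩
      have e : (p * ψ x + q * ψ y + r * ψ z + u) * (p' * ψ x + q' * ψ y + r' * ψ z + u') =
          p * p' * (ψ x * ψ x) + (p * q' + q * p') * (ψ x * ψ y) +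
          (p * r' + r * p') * (ψ x * ψ z) + (q * r' + r * q') * (ψ y * ψ z) +
          q * q' * (ψ y * ψ y) + r * r' * (ψ z * ψ z) +
          (p * ψ x + q * ψ y + r * ψ z + u) * u' + (p' * ψ x + q' * ψ y + r' * ψ z) * u := by
        ring
      rw [e]
      have hu2 := hNT (hUN hu)
      have hu2' := hNT (hUN hu')
      refine add_mem (add_mem (add_mem (add_mem (add_mem (add_mem (add_mem ?_ ?_) ?_) ?_) ?_) ?_)
        ?_) ?_ <;> apply Ideal.mul_mem_left
      exacts [hs.1, hs.2.1, hs.2.2.1, hs.2.2.2, hyy, hzz, hu2', hu2]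
    rintro g ⟨⟨hg₁, hg₂⟩, hg⟩
    obtain ⟨a, b, w, hw, rfl⟩ := mem_span_pair_sup.mp (hP2 hg)
    have hb : b * ψ z * ψ z ∈ Ideal.span {ψ x, ψ y} ⊔ U.map ψ := by
      have hy : a * (ψ y * ψ y) + w ∈ Ideal.span {ψ x, ψ y} ⊔ U.map ψ :=
        add_mem (Ideal.mul_mem_left _ _ (Ideal.mul_mem_left _ _
          ((le_sup_left : _ ≤ Ideal.span {ψ x, ψ y} ⊔ U.map ψ) (Ideal.subset_span (by simp)))))
          (hN₁ hw)
      convert! sub_mem hg₁ hy using 1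
      ring
    have ha : a * ψ y * ψ y ∈ Ideal.span {ψ x, ψ z} ⊔ U.map ψ := by
      have hz : b * (ψ z * ψ z) + w ∈ Ideal.span {ψ x, ψ z} ⊔ U.map ψ :=
        add_mem (Ideal.mul_mem_left _ _ (Ideal.mul_mem_left _ _
          ((le_sup_left : _ ≤ Ideal.span {ψ x, ψ z} ⊔ U.map ψ) (Ideal.subset_span (by simp)))))
          (hN₂ hw)
      convert! sub_mem hg₂ hz using 1
      ring
    -- Modulo the first line `b z²` vanishes, and modulo the second `a y²` does. Cancelling each
    -- square one factor at a time leaves `b` in the first ideal and `a` in the second, so both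
    -- terms fall into `N`.
    obtain ⟨p, q, u, hu, rfl⟩ := mem_span_pair_sup.mp (h₃ _ (h₃ _ hb))
    obtain ⟨p', q', u', hu', rfl⟩ := mem_span_pair_sup.mp (h₂ _ (h₂ _ ha))
    have e : (p' * ψ x + q' * ψ z + u') * (ψ y * ψ y) + (p * ψ x + q * ψ y + u) * (ψ z * ψ z) + w =
        (p' * ψ y) * (ψ x * ψ y) + (q' * ψ y + q * ψ z) * (ψ y * ψ z) + (p * ψ z) * (ψ x * ψ z) +
          (ψ y * ψ y) * u' + (ψ z * ψ z) * u + w := by ring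
    rw [e]
    exact add_mem (add_mem (add_mem (add_mem (add_mem (Ideal.mul_mem_left _ _ hxy)
      (Ideal.mul_mem_left _ _ hyz)) (Ideal.mul_mem_left _ _ hxz)) (Ideal.mul_mem_left _ _
      (hUN hu'))) (Ideal.mul_mem_left _ _ (hUN hu))) hw

end CommutativeAlgebra

end ZigZag

noncomputable section

namespace ZigZag

open MvPolynomial

/-! ### Coordinate subspaces in dual bases -/

section Coordinates

variable {n : ℕ} {R : Type u} [CommRing R]

/-- The linear forms vanishing on `W`. -/
def annihForms (W : Submodule R (Fin (n + 1) → R)) : Set (MvPolynomial (Fin (n + 1)) R) :=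
  {ℓ | ∃ c : Fin (n + 1) → R, (∀ w ∈ W, ∑ j, c j * w j = 0) ∧ ℓ = ∑ j, C (c j) * X j}

/-- The ideal sheaf of the reduced closed subscheme of `ℙⁿ_R` cut out by the linear forms vanishing
on `W`. -/
def linearSheaf (W : Submodule R (Fin (n + 1) → R)) : (PP n R).IdealSheafData :=
  Scheme.IdealSheafData.vanishingIdeal
    ⟨ProjectiveSpectrum.zeroLocus (homogeneousSubmodule (Fin (n + 1)) R) (annihForms W),
      ProjectiveSpectrum.isClosed_zeroLocus _ _⟩

/-- The span of some rows of a matrix. -/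
def rowSpan (V : Matrix (Fin (n + 1)) (Fin (n + 1)) R) (S : Finset (Fin (n + 1))) :
    Submodule R (Fin (n + 1) → R) :=
  Submodule.span R (V '' S)

/-- The ideal generated by the linear forms whose coefficients are the rows not in `S`. -/
def coordIdeal (B : Matrix (Fin (n + 1)) (Fin (n + 1)) R) (S : Finset (Fin (n + 1))) :
    Ideal (MvPolynomial (Fin (n + 1)) R) :=
  Ideal.span ((fun k ↦ lin (B k)) '' {k | k ∉ S})

theorem annihForms_mem (W : Submodule R (Fin (n + 1) → R)) :
    ∀ g ∈ annihForms W, g ∈ homogeneousSubmodule (Fin (n + 1)) R 1 := by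
  rintro _ ⟨c, -, rfl⟩
  exact lin_mem c

theorem lin_mem_coordIdeal_of_notMem {B : Matrix (Fin (n + 1)) (Fin (n + 1)) R}
    {S : Finset (Fin (n + 1))} {k : Fin (n + 1)} (hk : k ∉ S) : lin (B k) ∈ coordIdeal B S :=
  Ideal.subset_span ⟨k, hk, rfl⟩

variable {B V : Matrix (Fin (n + 1)) (Fin (n + 1)) R} (h : B * V.transpose = 1)
  (S : Finset (Fin (n + 1)))

include h

theorem transpose_dual : V * B.transpose = 1 := by
  rw [← Matrix.transpose_transpose V, ← Matrix.transpose_mul, h, Matrix.transpose_one]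

/-- The condition `B * Vᵀ = 1` is used throughout to say that the rows of `B` are the basis of
linear forms dual to the basis of vectors given by the rows of `V`. -/
theorem dual_dotProduct (k l : Fin (n + 1)) : B k ⬝ᵥ V l = if k = l then 1 else 0 := by
  rw [← Matrix.one_apply, ← h]
  rfl

theorem eq_sum_dotProduct_smul (c : Fin (n + 1) → R) : c = ∑ k, (c ⬝ᵥ V k) • B k := by
  have h1 : Matrix.vecMul c (V.transpose * B) = c := by
    rw [mul_eq_one_comm.mp h, Matrix.vecMul_one]
  conv_lhs => rw [← h1, ← Matrix.vecMul_vecMul, Matrix.vecMul_eq_sum]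
  rfl

theorem mem_rowSpan {w : Fin (n + 1) → R} :
    w ∈ rowSpan V S ↔ ∀ k ∉ S, B k ⬝ᵥ w = 0 := by
  constructor
  · intro hw k hk
    induction hw using Submodule.span_induction with
    | mem w hw =>
      obtain ⟨l, hl, rfl⟩ := hw
      rw [dual_dotProduct h, if_neg]
      rintro rfl
      exact hk hl
    | zero => simp
    | add v w _ _ hv hw => rw [dotProduct_add, hv, hw, add_zero]
    | smul r v _ hv => rw [dotProduct_smul, hv, smul_zero]
  · intro hw
    rw [eq_sum_dotProduct_smul (transpose_dual h) w]
    refine sum_mem fun k _ ↦ ?_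
    by_cases hk : k ∈ S
    · exact Submodule.smul_mem _ _ (Submodule.subset_span ⟨k, hk, rfl⟩)
    · rw [dotProduct_comm, hw k hk, zero_smul]
      exact zero_mem _

theorem rowSpan_inf_rowSpan (S T : Finset (Fin (n + 1))) :
    rowSpan V S ⊓ rowSpan V T = rowSpan V (S ∩ T) := by
  ext w
  simp only [Submodule.mem_inf, mem_rowSpan h, Finset.mem_inter, not_and_or]
  exact ⟨fun ⟨h1, h2⟩ k hk ↦ hk.elim (h1 k) (h2 k), fun h1 ↦
    ⟨fun k hk ↦ h1 k (Or.inl hk), fun k hk ↦ h1 k (Or.inr hk)⟩⟩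

theorem span_annihForms_rowSpan : Ideal.span (annihForms (rowSpan V S)) = coordIdeal B S := by
  apply le_antisymm
  · rw [Ideal.span_le]
    rintro _ ⟨c, hc, rfl⟩
    change lin c ∈ coordIdeal B S
    rw [eq_sum_dotProduct_smul h c, lin_sum]
    refine sum_mem fun k _ ↦ ?_
    rw [lin_smul]
    by_cases hk : k ∈ S
    · have : c ⬝ᵥ V k = 0 := hc _ (Submodule.subset_span ⟨k, hk, rfl⟩)
      rw [this, C_0, zero_mul]
      exact zero_mem _
    · exact Ideal.mul_mem_left _ _ (lin_mem_coordIdeal_of_notMem hk)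
  · rw [coordIdeal, Ideal.span_le]
    rintro _ ⟨k, hk, rfl⟩
    exact Ideal.subset_span ⟨B k, fun w hw ↦ (mem_rowSpan h S).mp hw k hk, rfl⟩

/-- The coordinate ideal is the kernel of a projection. -/
theorem exists_coordIdeal_eq_ker : ∃ θ : MvPolynomial (Fin (n + 1)) R →ₐ[R]
    MvPolynomial (Fin (n + 1)) R, RingHom.ker θ = coordIdeal B S ∧
      ∀ c, θ (lin c) = lin (∑ k ∈ S, (c ⬝ᵥ V k) • B k) := by
  -- Substitution of the projection that keeps the coordinates `lin (B k)` with `k ∈ S` and kills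
  -- the others.
  let θ : MvPolynomial (Fin (n + 1)) R →ₐ[R] MvPolynomial (Fin (n + 1)) R :=
    aeval fun j ↦ lin (∑ k ∈ S, V k j • B k)
  have hθ (c) : θ (lin c) = lin (∑ k ∈ S, (c ⬝ᵥ V k) • B k) := by
    have h1 : ∑ k ∈ S, (c ⬝ᵥ V k) • B k = ∑ j, c j • ∑ k ∈ S, V k j • B k := by
      simp only [dotProduct, Finset.sum_smul, Finset.smul_sum, smul_smul]
      exact Finset.sum_comm
    rw [h1, lin, map_sum, lin_sum]
    refine Finset.sum_congr rfl fun j _ ↦ ?_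
    rw [map_mul, aeval_X, lin_smul, MvPolynomial.algHom_C, MvPolynomial.algebraMap_eq]
  refine ⟨θ, le_antisymm (fun p hp ↦ ?_) ?_, hθ⟩
  · let π := Ideal.Quotient.mkₐ R (coordIdeal B S)
    -- Each variable changes under `θ` only by a combination of the generators, so `p` and `θ p`
    -- agree modulo the ideal; hence the kernel is contained in it.
    have h1 : π.comp θ = π := by
      refine MvPolynomial.algHom_ext fun j ↦ ?_
      rw [AlgHom.comp_apply, ← lin_single j, hθ, ← sub_eq_zero, ← map_sub, ← lin_sub]
      refine Ideal.Quotient.eq_zero_iff_mem.mpr ?_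
      set c : Fin (n + 1) → R := Pi.single j 1
      have h2 : ∑ k ∈ S, (c ⬝ᵥ V k) • B k - c = ∑ k ∈ Sᶜ, (-(c ⬝ᵥ V k)) • B k := by
        have h3 := eq_sum_dotProduct_smul h c
        rw [← Finset.sum_add_sum_compl S] at h3
        simp only [neg_smul, Finset.sum_neg_distrib]
        rw [sub_eq_iff_eq_add, neg_add_eq_sub, eq_sub_iff_add_eq]
        exact h3.symm
      rw [h2, lin_sum]
      refine sum_mem fun k hk ↦ ?_
      rw [lin_smul]
      exact Ideal.mul_mem_left _ _ (lin_mem_coordIdeal_of_notMem (Finset.mem_compl.mp hk))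
    have h2 : π p = 0 := by
      rw [← h1, AlgHom.comp_apply, (RingHom.mem_ker).mp hp, map_zero]
    exact Ideal.Quotient.eq_zero_iff_mem.mp h2
  · rw [coordIdeal, Ideal.span_le]
    rintro _ ⟨k, hk, rfl⟩
    change θ (lin (B k)) = 0
    rw [hθ, Finset.sum_eq_zero, lin_zero]
    intro l hl
    rw [dual_dotProduct h, if_neg, zero_smul]
    rintro rfl
    exact hk hl

theorem isPrime_coordIdeal [IsDomain R] : (coordIdeal B S).IsPrime := by
  obtain ⟨θ, hθ, -⟩ := exists_coordIdeal_eq_ker h S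
  rw [← hθ]
  exact RingHom.ker_isPrime θ

theorem lin_mem_coordIdeal {c : Fin (n + 1) → R} :
    lin c ∈ coordIdeal B S ↔ ∀ k ∈ S, c ⬝ᵥ V k = 0 := by
  constructor
  · intro hc l hl
    obtain ⟨θ, hθ, hlin⟩ := exists_coordIdeal_eq_ker h S
    rw [← hθ, RingHom.mem_ker, hlin] at hc
    have h1 := congr($(lin_eq_zero hc) ⬝ᵥ V l)
    rw [sum_dotProduct, Finset.sum_eq_single l, zero_dotProduct, smul_dotProduct,
      dual_dotProduct h, if_pos rfl, smul_eq_mul, mul_one] at h1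
    · exact h1
    · intro k _ hk
      rw [smul_dotProduct, dual_dotProduct h, if_neg hk, smul_zero]
    · exact fun h2 ↦ absurd hl h2
  · intro hc
    rw [eq_sum_dotProduct_smul h c, lin_sum]
    refine sum_mem fun k _ ↦ ?_
    rw [lin_smul]
    by_cases hk : k ∈ S
    · rw [hc k hk, C_0, zero_mul]
      exact zero_mem _
    · exact Ideal.mul_mem_left _ _ (lin_mem_coordIdeal_of_notMem hk)

theorem C_notMem_coordIdeal {r : R} (hr : r ≠ 0) : C r ∉ coordIdeal B S := by
  obtain ⟨θ, hθ, -⟩ := exists_coordIdeal_eq_ker h S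
  rw [← hθ, RingHom.mem_ker, MvPolynomial.algHom_C, MvPolynomial.algebraMap_eq, C_eq_zero]
  exact hr

variable {s : MvPolynomial (Fin (n + 1)) R} (hs : s ∈ homogeneousSubmodule (Fin (n + 1)) R 1)

theorem chart_linearSheaf_rowSpan [IsDomain R] :
    chart _ hs (linearSheaf (rowSpan V S)) = (coordIdeal B S).map (dehom hs) := by
  rw [← span_annihForms_rowSpan h]
  refine chart_vanishingIdeal_of_isPrime hs (annihForms_mem _) ?_
  rw [span_annihForms_rowSpan h]
  exact isPrime_coordIdeal h S

theorem mem_map_coordIdeal_of_mul_mem [IsDomain R] {q : MvPolynomial (Fin (n + 1)) R} {e : ℕ}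
    (hq : q ∈ homogeneousSubmodule (Fin (n + 1)) R e) (hqS : q ∉ coordIdeal B S)
    {a : HomogeneousLocalization.Away (homogeneousSubmodule (Fin (n + 1)) R) s}
    (ha : a * dehom hs q ∈ (coordIdeal B S).map (dehom hs)) :
    a ∈ (coordIdeal B S).map (dehom hs) := by
  refine mem_map_dehom_of_mul_mem hs ?_ (isPrime_coordIdeal h S) hq hqS ha
  rintro _ ⟨k, -, rfl⟩
  exact lin_mem _

end Coordinates

theorem map_coordIdeal {n : ℕ} {R T : Type u} [CommRing R] [CommRing T] (φ : R →+* T)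
    (B : Matrix (Fin (n + 1)) (Fin (n + 1)) R) (S : Finset (Fin (n + 1))) :
    (coordIdeal B S).map (MvPolynomial.map φ) = coordIdeal (B.map φ) S := by
  rw [coordIdeal, coordIdeal, Ideal.map_span, ← Set.image_comp]
  congr 2
  funext k
  exact map_lin φ (B k)

theorem map_map_dehom {n : ℕ} {R T : Type u} [CommRing R] [CommRing T] (φ : R →+* T)
    {s : MvPolynomial (Fin (n + 1)) R} (hs : s ∈ homogeneousSubmodule (Fin (n + 1)) R 1)
    (B : Matrix (Fin (n + 1)) (Fin (n + 1)) R) (S : Finset (Fin (n + 1))) :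
    ((coordIdeal B S).map (dehom hs)).map (HomogeneousLocalization.Away.map (coeffMap n φ) s) =
      (coordIdeal (B.map φ) S).map
        (dehom (show coeffMap n φ s ∈ homogeneousSubmodule (Fin (n + 1)) T 1 from
          (coeffMap n φ).2 hs)) := by
  rw [Ideal.map_map, ← map_coordIdeal, Ideal.map_map]
  congr 1
  exact RingHom.ext (map_dehom hs φ)

theorem finrank_rowSpan {n : ℕ} {K : Type u} [Field K]
    {B V : Matrix (Fin (n + 1)) (Fin (n + 1)) K} (h : B * V.transpose = 1)
    (S : Finset (Fin (n + 1))) : Module.finrank K (rowSpan V S) = S.card := by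
  have hV : LinearIndependent K V.row := Matrix.linearIndependent_rows_iff_isUnit.mpr
    (IsUnit.of_mul_eq_one _ (transpose_dual h))
  have h2 := finrank_span_eq_card (hV.comp ((↑) : S → Fin (n + 1)) Subtype.val_injective)
  have h3 : rowSpan V S = Submodule.span K (Set.range (V.row ∘ ((↑) : S → Fin (n + 1)))) := by
    rw [rowSpan, Set.range_comp, Subtype.range_coe]
    rfl
  rw [h3, h2, Fintype.card_coe]

end ZigZag

end

noncomputable section

namespace ZigZag

open MvPolynomial

/-! ### Two consecutive lines colliding -/

section Collision

variable {n : ℕ} {R T : Type u} [CommRing R] [CommRing T]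

/-- The matrix obtained from `M` by adding `c` times row `r` to row `p`. -/
def shear (M : Matrix (Fin (n + 1)) (Fin (n + 1)) R) (p r : Fin (n + 1)) (c : R) :
    Matrix (Fin (n + 1)) (Fin (n + 1)) R :=
  M.updateRow p (M p + c • M r)

theorem shear_self (M : Matrix (Fin (n + 1)) (Fin (n + 1)) R) (p r : Fin (n + 1)) (c : R) :
    shear M p r c p = M p + c • M r := Matrix.updateRow_self

theorem shear_of_ne (M : Matrix (Fin (n + 1)) (Fin (n + 1)) R) {p r k : Fin (n + 1)} (c : R)
    (hk : k ≠ p) : shear M p r c k = M k := Matrix.updateRow_ne hk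

/-- Adding `c` times `V r` to `V p` must be compensated in the dual basis by subtracting `c` times
`B p` from `B r`; hence the swapped indices and the sign. -/
theorem shear_dual {B V : Matrix (Fin (n + 1)) (Fin (n + 1)) R} (h : B * V.transpose = 1)
    {p r : Fin (n + 1)} (hpr : p ≠ r) (c : R) :
    shear B r p (-c) * (shear V p r c).transpose = 1 := by
  ext k l
  change shear B r p (-c) k ⬝ᵥ shear V p r c l = _
  have hd := dual_dotProduct h
  rw [Matrix.one_apply]
  by_cases hk : k = r <;> by_cases hl : l = p
  · subst hk hl
    simp [shear_self, hd, hpr, hpr.symm]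
  · subst hk
    simp only [shear_self, shear_of_ne V c hl, add_dotProduct, smul_dotProduct, hd,
      if_neg (Ne.symm hl)]
    simp
  · subst hl
    simp only [shear_self, shear_of_ne B (-c) hk, dotProduct_add, dotProduct_smul, hd,
      if_neg hk]
    simp
  · rw [shear_of_ne V c hl, shear_of_ne B (-c) hk, hd]

theorem map_dual {B V : Matrix (Fin (n + 1)) (Fin (n + 1)) R} (h : B * V.transpose = 1)
    (φ : R →+* T) : B.map φ * (V.map φ).transpose = 1 := by
  rw [← Matrix.transpose_map, ← Matrix.map_mul, h, Matrix.map_one φ (map_zero φ) (map_one φ)]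

theorem map_shear (M : Matrix (Fin (n + 1)) (Fin (n + 1)) R) (p r : Fin (n + 1)) (c : R)
    (φ : R →+* T) : (shear M p r c).map φ = shear (M.map φ) p r (φ c) := by
  ext k l
  by_cases hk : k = p <;> simp [shear, Matrix.updateRow_apply, hk]

/-- The homomorphism of charts of projective spaces induced by a change of constants. -/
def chartMap (φ : R →+* T) (s : MvPolynomial (Fin (n + 1)) R) :
    HomogeneousLocalization.Away (homogeneousSubmodule (Fin (n + 1)) R) s →+*
      HomogeneousLocalization.Away (homogeneousSubmodule (Fin (n + 1)) T) (coeffMap n φ s) :=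
  HomogeneousLocalization.Away.map (coeffMap n φ) s

theorem coeffMap_mem (φ : R →+* T) {s : MvPolynomial (Fin (n + 1)) R}
    (hs : s ∈ homogeneousSubmodule (Fin (n + 1)) R 1) :
    coeffMap n φ s ∈ homogeneousSubmodule (Fin (n + 1)) T 1 :=
  (coeffMap n φ).2 hs

theorem map_chart_linearSheaf [IsDomain R] [IsDomain T]
    {B V : Matrix (Fin (n + 1)) (Fin (n + 1)) R} (h : B * V.transpose = 1) (φ : R →+* T)
    (S : Finset (Fin (n + 1))) {s : MvPolynomial (Fin (n + 1)) R}
    (hs : s ∈ homogeneousSubmodule (Fin (n + 1)) R 1) :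
    (chart _ hs (linearSheaf (rowSpan V S))).map (chartMap φ s) =
      chart _ (coeffMap_mem φ hs) (linearSheaf (rowSpan (V.map φ) S)) := by
  rw [chart_linearSheaf_rowSpan h, chart_linearSheaf_rowSpan (map_dual h φ)]
  exact map_map_dehom φ hs B S

variable (q : Fin 4 ↪ Fin (n + 1))

/-- The forms outside the four chosen coordinates cut out the common `ℙ³`. Separating them gives the
ideal `U` of the collision lemma. -/
theorem coordIdeal_map (B : Matrix (Fin (n + 1)) (Fin (n + 1)) R) (S : Finset (Fin 4)) :
    coordIdeal B (S.map q) = Ideal.span ((fun k ↦ lin (B (q k))) '' {k | k ∉ S}) ⊔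
      coordIdeal B (Finset.univ.map q) := by
  rw [coordIdeal, coordIdeal, ← Ideal.span_union]
  congr 1
  ext g
  constructor
  · rintro ⟨k, hk, rfl⟩
    by_cases hkq : ∃ i, q i = k
    · obtain ⟨i, rfl⟩ := hkq
      exact Or.inl ⟨i, fun hi ↦ hk (Finset.mem_map_of_mem q hi), rfl⟩
    · refine Or.inr ⟨k, fun h ↦ hkq ?_, rfl⟩
      obtain ⟨i, -, hi⟩ := Finset.mem_map.mp h
      exact ⟨i, hi⟩
  · rintro (⟨i, hi, rfl⟩ | ⟨k, hk, rfl⟩)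
    · exact ⟨q i, fun h ↦ hi ((Finset.mem_map' q).mp h), rfl⟩
    · exact ⟨k, fun h ↦ hk (Finset.map_subset_map.mpr (Finset.subset_univ S) h), rfl⟩

theorem coordIdeal_congr {B B' : Matrix (Fin (n + 1)) (Fin (n + 1)) R} {S : Finset (Fin (n + 1))}
    (h : ∀ k ∉ S, B k = B' k) : coordIdeal B S = coordIdeal B' S := by
  rw [coordIdeal, coordIdeal]
  congr 1
  exact Set.image_congr fun k hk ↦ by rw [h k hk]

theorem map_dehom_coordIdeal {s : MvPolynomial (Fin (n + 1)) R}
    (hs : s ∈ homogeneousSubmodule (Fin (n + 1)) R 1)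
    (B : Matrix (Fin (n + 1)) (Fin (n + 1)) R) (S : Finset (Fin 4)) :
    (coordIdeal B (S.map q)).map (dehom hs) =
      Ideal.span ((fun k ↦ dehom hs (lin (B (q k)))) '' {k | k ∉ S}) ⊔
        (coordIdeal B (Finset.univ.map q)).map (dehom hs) := by
  rw [coordIdeal_map, Ideal.map_sup, Ideal.map_span, ← Set.image_comp]
  rfl

theorem compl_eq_pair {α : Type*} (f : Fin 4 → α) {S : Finset (Fin 4)} {i j : Fin 4}
    (h : Sᶜ = {i, j}) : f '' {k | k ∉ S} = {f i, f j} := by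
  have h2 : {k | k ∉ S} = ((Sᶜ : Finset (Fin 4)) : Set (Fin 4)) := by ext; simp
  rw [h2, h, Finset.coe_pair, Set.image_pair]

theorem compl_eq_triple {α : Type*} (f : Fin 4 → α) {S : Finset (Fin 4)} {i j k : Fin 4}
    (h : Sᶜ = {i, j, k}) : f '' {l | l ∉ S} = {f i, f j, f k} := by
  have h2 : {l | l ∉ S} = ((Sᶜ : Finset (Fin 4)) : Set (Fin 4)) := by ext; simp
  rw [h2, h, Finset.coe_insert, Finset.coe_pair, Set.image_insert_eq, Set.image_pair]

open Polynomial in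
/-- The limit of the union of two consecutive lines of the family, on a chart. -/
theorem map_chart_inf_chart {K : Type u} [Field K]
    {B V : Matrix (Fin (n + 1)) (Fin (n + 1)) K} (h : B * V.transpose = 1)
    {s : MvPolynomial (Fin (n + 1)) K[X]} (hs : s ∈ homogeneousSubmodule (Fin (n + 1)) K[X] 1) :
    (chart _ hs (linearSheaf (rowSpan (shear (V.map Polynomial.C) (q 0) (q 2) Polynomial.X)
        (Finset.map q {0, 1}))) ⊓
      chart _ hs (linearSheaf (rowSpan (shear (V.map Polynomial.C) (q 1) (q 3) Polynomial.X)
        (Finset.map q {1, 2})))).map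
        (chartMap (evalRingHom (0 : K)) s) =
      chart _ (coeffMap_mem (evalRingHom (0 : K)) hs)
        (linearSheaf (rowSpan V (Finset.map q {0, 1})) ⊓
          linearSheaf (rowSpan V (Finset.map q {1, 2})) ⊓
          (linearSheaf (rowSpan V (Finset.map q {1})) ^ 2 ⊔
            linearSheaf (rowSpan V (Finset.map q Finset.univ)))) := by
  have hs' : coeffMap n (evalRingHom (0 : K)) s ∈ homogeneousSubmodule (Fin (n + 1)) K 1 :=
    coeffMap_mem _ hs
  have hB : B.map Polynomial.C * (V.map Polynomial.C).transpose = 1 := map_dual h Polynomial.C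
  set BC : Matrix (Fin (n + 1)) (Fin (n + 1)) K[X] := B.map Polynomial.C
  set VC : Matrix (Fin (n + 1)) (Fin (n + 1)) K[X] := V.map Polynomial.C
  have hq {i j : Fin 4} (hij : i ≠ j) : q i ≠ q j := q.injective.ne hij
  have hnot {i : Fin 4} {k} (hk : k ∉ Finset.univ.map q) : k ≠ q i := fun h ↦
    hk (h ▸ Finset.mem_map_of_mem q (Finset.mem_univ i))
  have h02 := shear_dual hB (hq (show (0 : Fin 4) ≠ 2 by decide)) Polynomial.X
  have h13 := shear_dual hB (hq (show (1 : Fin 4) ≠ 3 by decide)) Polynomial.X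
  -- Shearing both vectors gives a basis over `K[t]` in which `y`, `x'`, `z` and `U` generate the
  -- ideal of the single point with coordinates `V (q 1) + t V (q 3)`.
  have h1302 := shear_dual h13 (hq (show (0 : Fin 4) ≠ 2 by decide)) Polynomial.X
  set U := (coordIdeal BC (Finset.univ.map q)).map (dehom hs)
  set x := dehom hs (lin (BC (q 3)))
  set y := dehom hs (lin (BC (q 2) + (-Polynomial.X : K[X]) • BC (q 0)))
  set x' := dehom hs (lin (BC (q 3) + (-Polynomial.X : K[X]) • BC (q 1)))
  set z := dehom hs (lin (BC (q 0)))
  have e₁ : chart _ hs (linearSheaf (rowSpan (shear VC (q 0) (q 2) Polynomial.X)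
      (Finset.map q {0, 1}))) = Ideal.span {x, y} ⊔ U := by
    rw [chart_linearSheaf_rowSpan h02, map_dehom_coordIdeal,
      compl_eq_pair (i := 3) (j := 2) _ (by decide), shear_self, shear_of_ne _ _ (hq (by decide)),
      coordIdeal_congr fun k hk ↦ shear_of_ne _ _ (hnot hk)]
  have e₂ : chart _ hs (linearSheaf (rowSpan (shear VC (q 1) (q 3) Polynomial.X)
      (Finset.map q {1, 2}))) = Ideal.span {x', z} ⊔ U := by
    rw [chart_linearSheaf_rowSpan h13, map_dehom_coordIdeal,
      compl_eq_pair (i := 3) (j := 0) _ (by decide), shear_self, shear_of_ne _ _ (hq (by decide)),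
      coordIdeal_congr fun k hk ↦ shear_of_ne _ _ (hnot hk)]
  have e₃ : (coordIdeal (shear (shear BC (q 3) (q 1) (-Polynomial.X)) (q 2) (q 0) (-Polynomial.X))
      (Finset.map q {1})).map (dehom hs) = Ideal.span {y, x', z} ⊔ U := by
    rw [map_dehom_coordIdeal, compl_eq_triple (i := 2) (j := 3) (k := 0) _ (by decide), shear_self,
      shear_of_ne _ _ (hq (show (3 : Fin 4) ≠ 2 by decide)),
      shear_of_ne _ _ (hq (show (0 : Fin 4) ≠ 2 by decide)), shear_self,
      shear_of_ne _ _ (hq (show (0 : Fin 4) ≠ 3 by decide)),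
      shear_of_ne _ _ (hq (show (2 : Fin 4) ≠ 3 by decide)),
      coordIdeal_congr fun k hk ↦ (shear_of_ne _ _ (hnot hk)).trans (shear_of_ne _ _ (hnot hk))]
  set ψ := chartMap (evalRingHom (0 : K)) s
  have hψ (c : Fin (n + 1) → K[X]) (d : Fin (n + 1) → K) (hcd : ∀ j, (c j).eval 0 = d j) :
      ψ (dehom hs (lin c)) = dehom hs' (lin d) := by
    have h1 := map_dehom hs (evalRingHom (0 : K)) (lin c)
    rw [map_lin] at h1
    refine h1.trans ?_
    congr 2
    exact funext hcd
  have hψx : ψ x = dehom hs' (lin (B (q 3))) := hψ _ _ fun j ↦ by simp [BC]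
  have hψx' : ψ x' = dehom hs' (lin (B (q 3))) := hψ _ _ fun j ↦ by simp [BC]
  have hψy : ψ y = dehom hs' (lin (B (q 2))) := hψ _ _ fun j ↦ by simp [BC]
  have hψz : ψ z = dehom hs' (lin (B (q 0))) := hψ _ _ fun j ↦ by simp [BC]
  have hU : U.map ψ = (coordIdeal B (Finset.univ.map q)).map (dehom hs') := by
    refine (map_map_dehom (evalRingHom (0 : K)) hs BC _).trans ?_
    congr 2
    ext; simp [BC]
  have f₁ : chart _ hs' (linearSheaf (rowSpan V (Finset.map q {0, 1}))) =
      Ideal.span {ψ x, ψ y} ⊔ U.map ψ := by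
    rw [chart_linearSheaf_rowSpan h, map_dehom_coordIdeal,
      compl_eq_pair (i := 3) (j := 2) _ (by decide), hψx, hψy, hU]
  have f₂ : chart _ hs' (linearSheaf (rowSpan V (Finset.map q {1, 2}))) =
      Ideal.span {ψ x, ψ z} ⊔ U.map ψ := by
    rw [chart_linearSheaf_rowSpan h, map_dehom_coordIdeal,
      compl_eq_pair (i := 3) (j := 0) _ (by decide), hψx, hψz, hU]
  have f₃ : chart _ hs' (linearSheaf (rowSpan V (Finset.map q {1}))) =
      Ideal.span {ψ x, ψ y, ψ z} ⊔ U.map ψ := by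
    rw [chart_linearSheaf_rowSpan h, map_dehom_coordIdeal,
      compl_eq_triple (i := 3) (j := 2) (k := 0) _ (by decide), hψx, hψy, hψz, hU]
  have f₄ : chart _ hs' (linearSheaf (rowSpan V (Finset.map q Finset.univ))) = U.map ψ := by
    rw [chart_linearSheaf_rowSpan h, hU]
  rw [chart_inf, chart_inf, chart_sup, chart_pow, f₁, f₂, f₃, f₄, e₁, e₂]
  apply map_inf_eq_of_collision U (hψx'.trans hψx.symm)
  · intro a ha
    -- The difference is `t` times the coordinate dual to `V (q 1)`. At the point `V (q 1) + t V (q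
    -- 3)` it takes the value `t ≠ 0`, so it can be cancelled modulo the prime ideal of that point.
    have hxx : x - x' = dehom hs (lin ((Polynomial.X : K[X]) • BC (q 1))) := by
      rw [← map_sub, ← lin_sub, neg_smul, sub_add_cancel_left, neg_neg]
    rw [← e₃, hxx] at ha
    rw [← e₃]
    refine mem_map_coordIdeal_of_mul_mem h1302 _ hs (lin_mem _) (fun hmem ↦ ?_) ha
    have h1 := (lin_mem_coordIdeal h1302 _).mp hmem (q 1)
      (Finset.mem_map_of_mem q (Finset.mem_singleton_self 1))
    rw [shear_of_ne _ _ (hq (show (1 : Fin 4) ≠ 0 by decide)), shear_self, smul_dotProduct,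
      dotProduct_add, dotProduct_smul, dual_dotProduct hB, dual_dotProduct hB, if_pos rfl,
      if_neg (hq (show (1 : Fin 4) ≠ 3 by decide)), smul_zero, add_zero, smul_eq_mul,
      mul_one] at h1
    exact Polynomial.X_ne_zero h1
  · intro b hb
    rw [← f₂, chart_linearSheaf_rowSpan h] at hb ⊢
    rw [hψy] at hb
    refine mem_map_coordIdeal_of_mul_mem h _ hs' (lin_mem (B (q 2))) (fun hmem ↦ ?_) hb
    have h1 := (lin_mem_coordIdeal h _).mp hmem (q 2) (Finset.mem_map_of_mem q (by decide))
    rw [dual_dotProduct h, if_pos rfl] at h1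
    exact one_ne_zero h1
  · intro b hb
    rw [← f₁, chart_linearSheaf_rowSpan h] at hb ⊢
    rw [hψz] at hb
    refine mem_map_coordIdeal_of_mul_mem h _ hs' (lin_mem (B (q 0))) (fun hmem ↦ ?_) hb
    have h1 := (lin_mem_coordIdeal h _).mp hmem (q 0) (Finset.mem_map_of_mem q (by decide))
    rw [dual_dotProduct h, if_pos rfl] at h1
    exact one_ne_zero h1

end Collision

end ZigZag

end

noncomputable section

namespace ZigZag

/-! ### The chain of lines and its disjointness -/

section Family

variable {n : ℕ} {R T : Type u} [CommRing R] [CommRing T]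

/-- The `i`-th member of a chain of lines spanned by a sequence of vectors, deformed by `c`. -/
def chainLine (w : ℕ → Fin (n + 1) → R) (c : R) (i : ℕ) : Submodule R (Fin (n + 1) → R) :=
  Submodule.span R {w i + c • w (i + 2), w (i + 1)}

/-- The matrix whose rows are consecutive members of a sequence of vectors. -/
def chainRows (w : ℕ → Fin (n + 1) → R) (i : ℕ) : Matrix (Fin (n + 1)) (Fin (n + 1)) R :=
  Matrix.of fun k ↦ w (i + k)

variable (hn : 3 ≤ n)

/-- The first four coordinates. -/
def firstFour : Fin 4 ↪ Fin (n + 1) := (Fin.castLEEmb (by omega))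

theorem rowSpan_map_pair (V : Matrix (Fin (n + 1)) (Fin (n + 1)) R) (q : Fin 4 ↪ Fin (n + 1))
    (k l : Fin 4) : rowSpan V (Finset.map q {k, l}) = Submodule.span R {V (q k), V (q l)} := by
  rw [rowSpan, Finset.coe_map, Finset.coe_pair, Set.image_pair]
  exact congrArg _ (Set.image_pair V.row _ _)

theorem chainLine_eq_rowSpan (w : ℕ → Fin (n + 1) → R) (c : R) (i : ℕ) :
    chainLine w c i = rowSpan (shear (chainRows w i) (firstFour hn 0) (firstFour hn 2) c)
      (Finset.map (firstFour hn) {0, 1}) := by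
  rw [rowSpan_map_pair, shear_self, shear_of_ne _ _ ((firstFour hn).injective.ne (by decide))]
  rfl

/-- Together with `chainLine_eq_rowSpan`, this expresses both consecutive lines through the one
basis `w i, …, w (i+n)`, by different shears. -/
theorem chainLine_succ_eq_rowSpan (w : ℕ → Fin (n + 1) → R) (c : R) (i : ℕ) :
    chainLine w c (i + 1) = rowSpan (shear (chainRows w i) (firstFour hn 1) (firstFour hn 3) c)
      (Finset.map (firstFour hn) {1, 2}) := by
  rw [rowSpan_map_pair, shear_self, shear_of_ne _ _ ((firstFour hn).injective.ne (by decide))]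
  rfl

theorem chainLine_zero_eq_rowSpan (w : ℕ → Fin (n + 1) → R) (i : ℕ) :
    chainLine w 0 i = rowSpan (chainRows w i) (Finset.map (firstFour hn) {0, 1}) := by
  rw [rowSpan_map_pair, chainLine, zero_smul, add_zero]
  rfl

theorem chainLine_zero_succ_eq_rowSpan (w : ℕ → Fin (n + 1) → R) (i : ℕ) :
    chainLine w 0 (i + 1) = rowSpan (chainRows w i) (Finset.map (firstFour hn) {1, 2}) := by
  rw [rowSpan_map_pair, chainLine, zero_smul, add_zero]
  rfl

/-- The first four coordinates of vectors spanning two members of a chain of lines. -/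
def chainMatrix (w : ℕ → Fin (n + 1) → R) (c : R) (i j : ℕ) : Matrix (Fin 4) (Fin 4) R :=
  Matrix.of fun k l ↦ (![w i + c • w (i + 2), w (i + 1), w j + c • w (j + 2), w (j + 1)] k)
    (firstFour hn l)

/-- A common vector is a linear relation among the four spanning vectors; nonvanishing of one 4×4
minor already forces it to be trivial. -/
theorem chainLine_inf_eq_bot {K : Type u} [Field K] {w : ℕ → Fin (n + 1) → K} {c : K} {i j : ℕ}
    (h : (chainMatrix hn w c i j).det ≠ 0) : chainLine w c i ⊓ chainLine w c j = ⊥ := by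
  rw [eq_bot_iff]
  rintro v ⟨h1, h2⟩
  obtain ⟨a, b, rfl⟩ := Submodule.mem_span_pair.mp h1
  obtain ⟨a', b', he⟩ := Submodule.mem_span_pair.mp h2
  have h3 : Matrix.vecMul ![a, b, -a', -b'] (chainMatrix hn w c i j) = 0 := by
    funext l
    have := congr($he (firstFour hn l))
    simp only [Pi.add_apply, Pi.smul_apply, smul_eq_mul] at this
    simp [Matrix.vecMul, dotProduct, Fin.sum_univ_four, chainMatrix]
    linear_combination -this
  have h4 := Matrix.eq_zero_of_vecMul_eq_zero h h3
  have ha : a = 0 := congr($h4 0)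
  have hb : b = 0 := congr($h4 1)
  simp [ha, hb]

theorem map_det_chainMatrix (φ : R →+* T) (w : ℕ → Fin (n + 1) → R) (c : R) (i j : ℕ) :
    φ (chainMatrix hn w c i j).det = (chainMatrix hn (fun i ↦ φ ∘ w i) (φ c) i j).det := by
  rw [RingHom.map_det]
  congr 1
  ext k l
  fin_cases k <;> simp [chainMatrix]

variable {K : Type u} [Field K]

/-- Points of the rational normal curve. -/
def momentCurve (n : ℕ) (a : ℕ → K) (i : ℕ) : Fin (n + 1) → K := fun j ↦ a i ^ (j : ℕ)

/-- Any `n + 1` consecutive points form a basis, by the Vandermonde determinant. -/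
theorem exists_dual_chainRows_momentCurve {a : ℕ → K} (ha : Function.Injective a) (i : ℕ) :
    ∃ B, B * (chainRows (momentCurve n a) i).transpose = 1 := by
  have h : (chainRows (momentCurve n a) i).det ≠ 0 := by
    refine Matrix.det_vandermonde_ne_zero_iff (v := fun k : Fin (n + 1) ↦ a (i + k)) |>.mpr ?_
    intro k l hkl
    have := ha hkl
    omega
  refine ⟨(chainRows (momentCurve n a) i).transpose⁻¹, Matrix.nonsing_inv_mul _ ?_⟩
  rw [Matrix.det_transpose]
  exact h.isUnit

theorem det_chainMatrix_momentCurve_ne_zero {a : ℕ → K} (ha : Function.Injective a) {i j : ℕ}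
    (hij : i + 1 < j) : (chainMatrix hn (momentCurve n a) 0 i j).det ≠ 0 := by
  have h : chainMatrix hn (momentCurve n a) 0 i j =
      Matrix.vandermonde ![a i, a (i + 1), a j, a (j + 1)] := by
    ext k l
    fin_cases k <;> simp [chainMatrix, momentCurve, Matrix.vandermonde_apply, firstFour]
  rw [h, Matrix.det_vandermonde_ne_zero_iff]
  intro k l hkl
  have e : ∀ k : Fin 4, ![a i, a (i + 1), a j, a (j + 1)] k = a (![i, i + 1, j, j + 1] k) := by
    intro k
    fin_cases k <;> rfl
  rw [e, e] at hkl
  have := ha hkl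
  fin_cases k <;> fin_cases l <;> first | rfl | (exfalso; simp at this; try omega)

/-- In dual coordinates `b₀, …, b₃`, one line has `b₃ = b₂ - c b₀ = 0` and the other `b₀ = b₃ - c b₁
= 0`, besides the common equations. Since `c ≠ 0`, all coordinates vanish. -/
theorem chainLine_inf_chainLine_succ (hn : 3 ≤ n) {w : ℕ → Fin (n + 1) → K} {i : ℕ}
    {B : Matrix (Fin (n + 1)) (Fin (n + 1)) K} (h : B * (chainRows w i).transpose = 1) {c : K}
    (hc : c ≠ 0) : chainLine w c i ⊓ chainLine w c (i + 1) = ⊥ := by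
  have hq {k l : Fin 4} (hkl : k ≠ l) : firstFour hn k ≠ firstFour hn l :=
    (firstFour hn).injective.ne hkl
  have h02 := shear_dual h (hq (show (0 : Fin 4) ≠ 2 by decide)) c
  have h13 := shear_dual h (hq (show (1 : Fin 4) ≠ 3 by decide)) c
  rw [eq_bot_iff, chainLine_eq_rowSpan hn, chainLine_succ_eq_rowSpan hn]
  rintro v ⟨h1, h2⟩
  have h1 := (mem_rowSpan h02 _).mp h1
  have h2 := (mem_rowSpan h13 _).mp h2
  have e0 : B (firstFour hn 0) ⬝ᵥ v = 0 := by
    have := h2 (firstFour hn 0) (by simp)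
    rwa [shear_of_ne _ _ (hq (by decide))] at this
  have e3 : B (firstFour hn 3) ⬝ᵥ v = 0 := by
    have := h1 (firstFour hn 3) (by simp)
    rwa [shear_of_ne _ _ (hq (by decide))] at this
  have e2 : B (firstFour hn 2) ⬝ᵥ v = 0 := by
    have := h1 (firstFour hn 2) (by simp)
    rwa [shear_self, add_dotProduct, smul_dotProduct, e0, smul_zero, add_zero] at this
  have e1 : B (firstFour hn 1) ⬝ᵥ v = 0 := by
    have := h2 (firstFour hn 3) (by simp)
    rw [shear_self, add_dotProduct, smul_dotProduct, e3, zero_add, smul_eq_mul] at this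
    exact (mul_eq_zero.mp this).resolve_left (neg_ne_zero.mpr hc)
  have e : ∀ k, B k ⬝ᵥ v = 0 := by
    intro k
    by_cases hk : ∃ l, firstFour hn l = k
    · obtain ⟨l, rfl⟩ := hk
      fin_cases l
      exacts [e0, e1, e2, e3]
    · have hk' (l : Fin 4) : k ≠ firstFour hn l := fun hl ↦ hk ⟨l, hl.symm⟩
      have := h1 k (by simp [hk'])
      rwa [shear_of_ne _ _ (hk' 2)] at this
  rw [Submodule.mem_bot, eq_sum_dotProduct_smul (transpose_dual h) v]
  refine Finset.sum_eq_zero fun k _ ↦ ?_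
  rw [dotProduct_comm, e, zero_smul]

/-- For disjoint subspaces, every linear form is a sum of forms vanishing on either. -/
theorem exists_add_eq_of_inf_eq_bot {W W' : Submodule K (Fin (n + 1) → K)} (h : W ⊓ W' = ⊥)
    (c : Fin (n + 1) → K) : ∃ d d' : Fin (n + 1) → K, (∀ w ∈ W, ∑ j, d j * w j = 0) ∧
      (∀ w ∈ W', ∑ j, d' j * w j = 0) ∧ d + d' = c := by
  have hf : (dotProductEquiv K (Fin (n + 1)) c) ∈ W.dualAnnihilator ⊔ W'.dualAnnihilator := by
    rw [← Subspace.dualAnnihilator_inf_eq, h, Submodule.dualAnnihilator_bot]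
    exact Submodule.mem_top
  obtain ⟨f, hf, f', hf', he⟩ := Submodule.mem_sup.mp hf
  obtain ⟨d, rfl⟩ := (dotProductEquiv K (Fin (n + 1))).surjective f
  obtain ⟨d', rfl⟩ := (dotProductEquiv K (Fin (n + 1))).surjective f'
  rw [← map_add] at he
  exact ⟨d, d', fun w hw ↦ (Submodule.mem_dualAnnihilator _).mp hf w hw,
    fun w hw ↦ (Submodule.mem_dualAnnihilator _).mp hf' w hw,
    (dotProductEquiv K (Fin (n + 1))).injective he⟩

/-- The form `s` itself splits as a sum of forms vanishing on the two subspaces; dividing by `s`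
writes 1 as a sum of elements of the two ideals. -/
theorem chart_sup_chart_eq_top {W W' : Submodule K (Fin (n + 1) → K)} (h : W ⊓ W' = ⊥)
    {s : MvPolynomial (Fin (n + 1)) K}
    (hs : s ∈ MvPolynomial.homogeneousSubmodule (Fin (n + 1)) K 1) {c : Fin (n + 1) → K}
    (hc : s = lin c) : chart _ hs (linearSheaf W) ⊔ chart _ hs (linearSheaf W') = ⊤ := by
  obtain ⟨d, d', hd, hd', rfl⟩ := exists_add_eq_of_inf_eq_bot h c
  have hmem {W : Submodule K (Fin (n + 1) → K)} {d : Fin (n + 1) → K}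
      (hd : ∀ w ∈ W, ∑ j, d j * w j = 0) : dehom hs (lin d) ∈ chart _ hs (linearSheaf W) := by
    rw [linearSheaf, chart_vanishingIdeal_zeroLocus hs (annihForms_mem W)]
    refine Ideal.le_radical (Ideal.subset_span ⟨lin d, ⟨d, hd, rfl⟩, ?_⟩)
    exact dehom_eq_mk hs (lin_mem d)
  have h1 : dehom hs (lin d) + dehom hs (lin d') = 1 := by
    rw [← map_add, ← lin_add, ← hc, dehom_self]
  rw [Ideal.eq_top_iff_one, ← h1]
  exact Submodule.add_mem_sup (hmem hd) (hmem hd')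

end Family

end ZigZag

end

noncomputable section

namespace ZigZag

/-! ### Flatness and fibres of the family -/

section Members

variable {n : ℕ}

/-- Over a Dedekind domain, flat is the same as torsion-free. -/
theorem isFlatFamily_of_mul_chartC_mem {R : Type u} [CommRing R] [IsDedekindDomain R]
    (I : (PP n R).IdealSheafData) (h : ∀ (j : Fin (n + 1)) (r : R) (_ : r ≠ 0) a,
      a * chartC n R (MvPolynomial.X j) r ∈ chart _ (X_mem_homogeneousSubmodule j) I →
        a ∈ chart _ (X_mem_homogeneousSubmodule j) I) : IsFlatFamily I := by
  refine isFlatFamily_of_chart I fun j ↦ ?_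
  set f := (Ideal.Quotient.mk (chart _ (X_mem_homogeneousSubmodule j) I)).comp
    (chartC n R (MvPolynomial.X j))
  algebraize [f]
  have : Module.IsTorsionFree R
      (HomogeneousLocalization.Away (MvPolynomial.homogeneousSubmodule (Fin (n + 1)) R)
        (MvPolynomial.X j) ⧸ chart _ (X_mem_homogeneousSubmodule j) I) := by
    refine Module.IsTorsionFree.of_smul_eq_zero fun r m hm ↦ or_iff_not_imp_left.mpr fun hr ↦ ?_
    obtain ⟨a, rfl⟩ := Ideal.Quotient.mk_surjective m
    rw [Algebra.smul_def, mul_comm] at hm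
    change Ideal.Quotient.mk _ a * Ideal.Quotient.mk _ (chartC n R (MvPolynomial.X j) r) = 0 at hm
    rw [← map_mul, Ideal.Quotient.eq_zero_iff_mem] at hm
    exact Ideal.Quotient.eq_zero_iff_mem.mpr (h j r hr a hm)
  change Module.Flat R _
  infer_instance

theorem mem_chart_rowSpan_of_mul_chartC_mem {R : Type u} [CommRing R] [IsDomain R]
    {B V : Matrix (Fin (n + 1)) (Fin (n + 1)) R} (h : B * V.transpose = 1)
    (S : Finset (Fin (n + 1))) {s : MvPolynomial (Fin (n + 1)) R}
    (hs : s ∈ MvPolynomial.homogeneousSubmodule (Fin (n + 1)) R 1) {r : R} (hr : r ≠ 0)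
    {a : HomogeneousLocalization.Away (MvPolynomial.homogeneousSubmodule (Fin (n + 1)) R) s}
    (ha : a * chartC n R s r ∈ chart _ hs (linearSheaf (rowSpan V S))) :
    a ∈ chart _ hs (linearSheaf (rowSpan V S)) := by
  rw [chart_linearSheaf_rowSpan h] at ha ⊢
  rw [← dehom_C hs] at ha
  exact mem_map_coordIdeal_of_mul_mem h S hs (MvPolynomial.isHomogeneous_C _ r)
    (C_notMem_coordIdeal h S hr) ha

/-- Ideal sheaves on `ℙⁿ_T` are determined by the charts that come from `ℙⁿ_R`. -/
theorem ext_of_chart_coeffMap {R T : Type u} [CommRing R] [CommRing T] (φ : R →+* T)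
    {I J : (PP n T).IdealSheafData}
    (h : ∀ j : Fin (n + 1), chart _ (coeffMap_mem φ (X_mem_homogeneousSubmodule j)) I =
      chart _ (coeffMap_mem φ (X_mem_homogeneousSubmodule j)) J) : I = J := by
  refine ext_of_chart (fun j ↦ coeffMap_mem φ (X_mem_homogeneousSubmodule j)) ?_ h
  have hX : (fun j : Fin (n + 1) ↦ coeffMap n φ (MvPolynomial.X j)) = MvPolynomial.X :=
    funext fun j ↦ MvPolynomial.map_X φ j
  rw [hX]
  exact irrelevant_le_span_X

theorem coeffMap_X_eq_lin {R T : Type u} [CommRing R] [CommRing T] (φ : R →+* T)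
    (j : Fin (n + 1)) : coeffMap n φ (MvPolynomial.X j) = lin (Pi.single j 1) := by
  rw [lin_single]
  exact MvPolynomial.map_X φ j

variable {K : Type u} [Field K]

theorem chart_member {s : MvPolynomial (Fin (n + 1)) (Polynomial K)}
    (hs : s ∈ MvPolynomial.homogeneousSubmodule (Fin (n + 1)) (Polynomial K) 1)
    (I : (PP n (Polynomial K)).IdealSheafData) (a : K) :
    chart _ (coeffMap_mem (Polynomial.evalRingHom a) hs) (member I a) =
      (chart _ hs I).map (chartMap (Polynomial.evalRingHom a) s) :=
  chart_comap_map hs _ _ I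

theorem chartMap_evalRingHom_surjective (a : K) {s : MvPolynomial (Fin (n + 1)) (Polynomial K)}
    (hs : s ∈ MvPolynomial.homogeneousSubmodule (Fin (n + 1)) (Polynomial K) 1) :
    Function.Surjective (chartMap (Polynomial.evalRingHom a) s) := by
  intro b
  obtain ⟨-, p, -, rfl⟩ := exists_dehom_eq (coeffMap_mem (Polynomial.evalRingHom a) hs) b
  have h : (Polynomial.evalRingHom a).comp Polynomial.C = RingHom.id K := by
    ext
    simp
  refine ⟨dehom hs (MvPolynomial.map Polynomial.C p), (map_dehom hs _ _).trans ?_⟩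
  rw [MvPolynomial.map_map, h, MvPolynomial.map_id]

/-- The intersection of the ideals of a chain of lines over `K[t]` that is deformed by `t`. -/
def chainFamily (w : ℕ → Fin (n + 1) → K) (z : ℕ) : (PP n (Polynomial K)).IdealSheafData :=
  ⨅ i : Fin z, linearSheaf (chainLine (fun i ↦ Polynomial.C ∘ w i) Polynomial.X i)

variable {w : ℕ → Fin (n + 1) → K}

theorem chainLine_C_eq_rowSpan (hn : 3 ≤ n) (w : ℕ → Fin (n + 1) → K) (i : ℕ) :
    chainLine (fun i ↦ Polynomial.C ∘ w i) Polynomial.X i =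
      rowSpan (shear ((chainRows w i).map Polynomial.C) (firstFour hn 0) (firstFour hn 2)
        Polynomial.X) (Finset.map (firstFour hn) {0, 1}) :=
  chainLine_eq_rowSpan hn _ _ i

theorem chainLine_C_succ_eq_rowSpan (hn : 3 ≤ n) (w : ℕ → Fin (n + 1) → K) (i : ℕ) :
    chainLine (fun i ↦ Polynomial.C ∘ w i) Polynomial.X (i + 1) =
      rowSpan (shear ((chainRows w i).map Polynomial.C) (firstFour hn 1) (firstFour hn 3)
        Polynomial.X) (Finset.map (firstFour hn) {1, 2}) :=
  chainLine_succ_eq_rowSpan hn _ _ i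

theorem rowSpan_mono (V : Matrix (Fin (n + 1)) (Fin (n + 1)) K) {S T : Finset (Fin (n + 1))}
    (h : S ⊆ T) : rowSpan V S ≤ rowSpan V T :=
  Submodule.span_mono (Set.image_mono (Finset.coe_subset.mpr h))

variable (hn : 3 ≤ n) (hw : ∀ i, ∃ B, B * (chainRows w i).transpose = 1)

include hn hw

theorem isFlatFamily_chainFamily (z : ℕ) : IsFlatFamily (chainFamily w z) := by
  refine isFlatFamily_of_mul_chartC_mem _ fun j r hr a ha ↦ ?_
  rw [chainFamily, chart_iInf, Ideal.mem_iInf] at ha ⊢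
  intro i
  obtain ⟨B, hB⟩ := hw i
  have ha := ha i
  rw [chainLine_C_eq_rowSpan hn] at ha ⊢
  exact mem_chart_rowSpan_of_mul_chartC_mem (shear_dual (map_dual hB Polynomial.C)
    ((firstFour hn).injective.ne (by decide)) _) _ _ hr ha

theorem map_chart_chainLine (a : K) (i : ℕ) {s : MvPolynomial (Fin (n + 1)) (Polynomial K)}
    (hs : s ∈ MvPolynomial.homogeneousSubmodule (Fin (n + 1)) (Polynomial K) 1) :
    (chart _ hs (linearSheaf (chainLine (fun i ↦ Polynomial.C ∘ w i) Polynomial.X i))).map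
      (chartMap (Polynomial.evalRingHom a) s) =
    chart _ (coeffMap_mem (Polynomial.evalRingHom a) hs) (linearSheaf (chainLine w a i)) := by
  obtain ⟨B, hB⟩ := hw i
  have h : ((chainRows w i).map Polynomial.C).map (Polynomial.evalRingHom a) = chainRows w i := by
    ext
    simp
  rw [chainLine_C_eq_rowSpan hn, map_chart_linearSheaf (shear_dual (map_dual hB Polynomial.C)
    ((firstFour hn).injective.ne (by decide)) _), map_shear, h, chainLine_eq_rowSpan hn]
  simp

theorem member_chainFamily_of_disjoint {z : ℕ} {a : K}
    (h : ∀ i j : Fin z, i ≠ j → chainLine w a i ⊓ chainLine w a j = ⊥) :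
    member (chainFamily w z) a = ⨅ i : Fin z, linearSubspace (chainLine w a i) := by
  refine ext_of_chart_coeffMap (Polynomial.evalRingHom a) fun j ↦ ?_
  have hs := X_mem_homogeneousSubmodule (R := Polynomial K) j
  rw [chart_member hs, chainFamily, chart_iInf, chart_iInf, map_iInf_of_pairwise_isCoprime]
  -- Over `K`, `linearSheaf` and `linearSubspace` agree by unfolding.
  · exact iInf_congr fun i ↦ map_chart_chainLine hn hw a i hs
  · intro k l hkl
    rw [map_chart_chainLine hn hw, map_chart_chainLine hn hw]
    exact chart_sup_chart_eq_top (h k l hkl) _ (coeffMap_X_eq_lin _ j)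

theorem finrank_chainLine (a : K) (i : ℕ) : Module.finrank K (chainLine w a i) = 2 := by
  obtain ⟨B, hB⟩ := hw i
  rw [chainLine_eq_rowSpan hn, finrank_rowSpan (shear_dual hB
    ((firstFour hn).injective.ne (by decide)) a), Finset.card_map]
  rfl

theorem isUnionOfDisjointLines_member_chainFamily {z : ℕ} {a : K} (ha : a ≠ 0)
    (h : ∀ i j, i + 1 < j → j < z → chainLine w a i ⊓ chainLine w a j = ⊥) :
    IsUnionOfDisjointLines z (member (chainFamily w z) a) := by
  have hlt (i j : Fin z) (hij : i < j) : chainLine w a i ⊓ chainLine w a j = ⊥ := by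
    obtain hj | hj := (Nat.succ_le_of_lt hij).eq_or_lt
    · obtain ⟨B, hB⟩ := hw i
      rw [← hj]
      exact chainLine_inf_chainLine_succ hn hB ha
    · exact h i j hj j.2
  have hne (i j : Fin z) (hij : i ≠ j) : chainLine w a i ⊓ chainLine w a j = ⊥ := by
    obtain hij | hij := hij.lt_or_gt
    · exact hlt i j hij
    · rw [inf_comm, hlt j i hij]
  exact ⟨fun i ↦ chainLine w a i, fun i ↦ finrank_chainLine hn hw a i, hne,
    member_chainFamily_of_disjoint hn hw hne⟩

theorem chainLine_zero_inf_succ (i : ℕ) : chainLine w 0 i ⊓ chainLine w 0 (i + 1) =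
    rowSpan (chainRows w i) (Finset.map (firstFour hn) {1}) := by
  obtain ⟨B, hB⟩ := hw i
  rw [chainLine_zero_eq_rowSpan hn, chainLine_zero_succ_eq_rowSpan hn, rowSpan_inf_rowSpan hB,
    ← Finset.map_inter]
  rfl

theorem map_chart_chainLine_inf_succ (i : ℕ) {s : MvPolynomial (Fin (n + 1)) (Polynomial K)}
    (hs : s ∈ MvPolynomial.homogeneousSubmodule (Fin (n + 1)) (Polynomial K) 1) :
    (chart _ hs (linearSheaf (chainLine (fun i ↦ Polynomial.C ∘ w i) Polynomial.X i)) ⊓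
      chart _ hs (linearSheaf (chainLine (fun i ↦ Polynomial.C ∘ w i) Polynomial.X (i + 1)))).map
      (chartMap (Polynomial.evalRingHom (0 : K)) s) =
    chart _ (coeffMap_mem (Polynomial.evalRingHom (0 : K)) hs) (linearSheaf (chainLine w 0 i)) ⊓
      chart _ (coeffMap_mem (Polynomial.evalRingHom (0 : K)) hs)
        (linearSheaf (chainLine w 0 (i + 1))) ⊓
      chart _ (coeffMap_mem (Polynomial.evalRingHom (0 : K)) hs)
        (linearSubspace (chainLine w 0 i ⊓ chainLine w 0 (i + 1)) ^ 2 ⊔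
          linearSubspace (rowSpan (chainRows w i) (Finset.map (firstFour hn) Finset.univ))) := by
  obtain ⟨B, hB⟩ := hw i
  rw [chainLine_C_eq_rowSpan hn, chainLine_C_succ_eq_rowSpan hn, map_chart_inf_chart _ hB,
    chainLine_zero_inf_succ hn hw, chainLine_zero_eq_rowSpan hn,
    chainLine_zero_succ_eq_rowSpan hn, chart_inf, chart_inf]
  rfl

theorem member_chainFamily_zero {z : ℕ} (hz : 2 ≤ z)
    (h : ∀ i j, i + 1 < j → j < z → chainLine w 0 i ⊓ chainLine w 0 j = ⊥) :
    member (chainFamily w z) 0 = (⨅ i : Fin z, linearSubspace (chainLine w 0 i)) ⊓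
      ⨅ i : Fin (z - 1), (linearSubspace (chainLine w 0 i ⊓ chainLine w 0 (i + 1)) ^ 2 ⊔
        linearSubspace (rowSpan (chainRows w i) (Finset.map (firstFour hn) Finset.univ))) := by
  refine ext_of_chart_coeffMap (Polynomial.evalRingHom (0 : K)) fun j ↦ ?_
  have hs := X_mem_homogeneousSubmodule (R := Polynomial K) j
  have hline (i : ℕ) := map_chart_chainLine hn hw 0 i hs
  rw [chart_member hs, chainFamily, chart_iInf, chart_inf, chart_iInf, chart_iInf]
  -- The correction ideal `Q i` is the infinitesimal neighbourhood of the `i`-th node in the `ℙ³`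
  -- spanned by `w i, …, w (i+3)`. The last vector is in neither limit line: it records the
  -- direction in which line `i + 1` leaves the node.
  refine (map_iInf_of_chain (chartMap_evalRingHom_surjective (0 : K) hs) hz
    (fun i ↦ chart _ hs (linearSheaf (chainLine (fun i ↦ Polynomial.C ∘ w i) Polynomial.X i)))
    (fun i ↦ chart _ (coeffMap_mem (Polynomial.evalRingHom (0 : K)) hs)
      (linearSubspace (chainLine w 0 i ⊓ chainLine w 0 (i + 1)) ^ 2 ⊔
        linearSubspace (rowSpan (chainRows w i) (Finset.map (firstFour hn) Finset.univ))))
    (fun i k hik hk ↦ ?_) fun i _ ↦ ?_).trans ?_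
  · rw [hline, hline]
    exact chart_sup_chart_eq_top (h i k hik hk) _ (coeffMap_X_eq_lin _ j)
  · rw [hline, hline]
    exact map_chart_chainLine_inf_succ hn hw i hs
  · exact congrArg₂ _ (iInf_congr fun i ↦ hline i) rfl

theorem isZigZag_member_chainFamily {z : ℕ} (hz : 2 ≤ z)
    (h : ∀ i j, i + 1 < j → j < z → chainLine w 0 i ⊓ chainLine w 0 j = ⊥) :
    IsZigZag z (member (chainFamily w z) 0) := by
  refine ⟨chainLine w 0, fun i ↦ rowSpan (chainRows w i) (Finset.map (firstFour hn) Finset.univ),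
    fun i _ ↦ finrank_chainLine hn hw 0 i, fun i _ ↦ ?_, h, fun i _ ↦ ⟨?_, sup_le ?_ ?_⟩,
    member_chainFamily_zero hn hw hz h⟩
  · obtain ⟨B, hB⟩ := hw i
    rw [chainLine_zero_inf_succ hn hw, finrank_rowSpan hB, Finset.card_map]
    rfl
  · obtain ⟨B, hB⟩ := hw i
    rw [finrank_rowSpan hB, Finset.card_map]
    rfl
  · rw [chainLine_zero_eq_rowSpan hn]
    exact rowSpan_mono _ (Finset.map_subset_map.mpr (Finset.subset_univ _))
  · rw [chainLine_zero_succ_eq_rowSpan hn]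
    exact rowSpan_mono _ (Finset.map_subset_map.mpr (Finset.subset_univ _))

end Members

end ZigZag

end

theorem mainTheorem5 (K : Type u) [Field K] [Infinite K] (n z : ℕ) (hn : 3 ≤ n) (hz : 2 ≤ z) :
    ∃ X : (ZigZag.PP n (Polynomial K)).IdealSheafData,
      ZigZag.IsFlatFamily X ∧
      (∃ E : Finset K, ∀ a : K, a ∉ E → ZigZag.IsUnionOfDisjointLines z (ZigZag.member X a)) ∧
      ZigZag.IsZigZag z (ZigZag.member X 0) := by
  classical
  -- An infinite sequence of distinct parameters keeps `w (i + k)` available past the last line.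
  let a := Infinite.natEmbedding K
  let w := ZigZag.momentCurve n a
  let D (i j : ℕ) : Polynomial K :=
    (ZigZag.chainMatrix hn (fun i ↦ Polynomial.C ∘ w i) Polynomial.X i j).det
  have hD (i j : ℕ) (c : K) : (D i j).eval c = (ZigZag.chainMatrix hn w c i j).det := by
    have h := ZigZag.map_det_chainMatrix hn (Polynomial.evalRingHom c)
      (fun i ↦ Polynomial.C ∘ w i) Polynomial.X i j
    have hC : (fun i ↦ Polynomial.evalRingHom c ∘ Polynomial.C ∘ w i) = w := by
      funext i k
      simp
    rwa [hC, Polynomial.coe_evalRingHom, Polynomial.eval_X] at h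
  have hD0 {i j : ℕ} (hij : i + 1 < j) : (ZigZag.chainMatrix hn w 0 i j).det ≠ 0 :=
    ZigZag.det_chainMatrix_momentCurve_ne_zero hn a.injective hij
  have hw (i : ℕ) := ZigZag.exists_dual_chainRows_momentCurve (n := n) a.injective i
  refine ⟨ZigZag.chainFamily w z, ZigZag.isFlatFamily_chainFamily hn hw z,
    -- Zero is excluded because consecutive lines meet there. Pairs with `j ≤ i + 1` are included
    -- harmlessly: even the zero polynomial has a finite `roots` multiset, the empty one.
    ⟨insert 0 ((Finset.range z ×ˢ Finset.range z).biUnion fun p ↦ (D p.1 p.2).roots.toFinset),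
      fun c hc ↦ ?_⟩, ZigZag.isZigZag_member_chainFamily hn hw hz fun i j hij _ ↦
        ZigZag.chainLine_inf_eq_bot hn (hD0 hij)⟩
  simp only [Finset.mem_insert, Finset.mem_biUnion, not_or, not_exists, not_and] at hc
  refine ZigZag.isUnionOfDisjointLines_member_chainFamily hn hw hc.1 fun i j hij hj ↦
    ZigZag.chainLine_inf_eq_bot hn fun h0 ↦ hc.2 (i, j) ?_ ?_
  · exact Finset.mem_product.mpr ⟨Finset.mem_range.mpr (by omega), Finset.mem_range.mpr hj⟩
  · rw [Multiset.mem_toFinset, Polynomial.mem_roots']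
    -- The determinant is a nonzero polynomial because its value at 0 is a nonzero Vandermonde
    -- determinant.
    refine ⟨fun h ↦ hD0 hij ?_, (hD i j c).trans h0⟩
    rw [← hD, h, Polynomial.eval_zero]
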